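/- Let $a=\frac{\sqrt5+1}{4}$, $b=\frac{\sqrt5-1}{4}$, and let $R\subset V_0=\mathbb R^4$ be the root system of type $H_4$ consisting of the 120 vectors obtained from $\sqrt2(1,0,0,0)$, $\sqrt2(\frac12,\frac12,\frac12,\frac12)$, $\sqrt2(a,\frac12,b,0)$ by even permutations of coordinates and arbitrary sign changes, with simple roots $\Delta=\{\alpha_1,\alpha_2,\alpha_3,\alpha_4\}$, where $\alpha_1=\sqrt2(-\frac12,-a,0,b)$, $\alpha_2=\sqrt2(\frac12,b,-a,0)$, $\alpha_3=\sqrt2(-a,\frac12,b,0)$, $\alpha_4=\sqrt2(a,-\frac12,b,0)$. Let $R^{\pm}$ be the sets of positive and negative roots, $W$ the group generated by the reflections $s_\alpha(v)=v-\alpha^\vee(v)\alpha$ with $\alpha^\vee=\frac{2\langle\alpha,\cdot\rangle}{\langle\alpha,\alpha\rangle}$ ($\alpha\in R$), $V=\mathbb C\otimes V_0$, and $V^\vee$ its dual, with $(w\chi)(v)=\chi(w^{-1}v)$. Let $c=\frac12$, and let $\mathbb H$ be the graded Hecke algebra, the unital associative $\mathbb C$-algebra generated by $\mathbb C[W]$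 (with basis $t_w$, $w\in W$) and $S(V)$ with relations $t_{s_\alpha}v-s_\alpha(v)t_{s_\alpha}=c\,\alpha^\vee(v)$ for $\alpha\in\Delta$, $v\in V$. For $\chi\in V^\vee$ put $Z(\chi)=\{\alpha\in R^+:\chi(\alpha)=0\}$ and $P(\chi)=\{\alpha\in R:\chi(\alpha)=c\}$. For $J\subseteq P(\chi)$ let $\mathcal F^{(\chi,J)}$ be the set of $w\in W$ such that no $\alpha\in Z(\chi)$ has $w\alpha\in R^-$, such that $w\beta\in R^-$ for $\beta\in J$, and such that $w\beta\in R^+$ for $\beta\in P(\chi)\setminus J$. The pair $(\chi,J)$ is a *skew local region* if $\mathcal F^{(\chi,J)}\ne\emptyset$ and, for all $w\in\mathcal F^{(\chi,J)}$: (1) $(w\chi)(\gamma)\neq0$ for all $\gamma\in\Delta$; (2) for all $\alpha\ne\beta$ in $\Delta$, with $R_{\alpha\beta}=R\cap\mathrm{span}(\alpha,\beta)$, if $(w\chi)(\gamma)=0$ for some $\gamma\in R_{\alpha\beta}$, then $\{\gamma\in R_{\alpha\beta}:(w\chi)(\gamma)=\pm c\}$ has more than two elements. For an ordering $P(\chi)=\{\beta^1,\dots,\beta^r\}$,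 $\mathcal F^{(\chi,J)}$ *has the sign* $(\epsilon_1,\dots,\epsilon_r)$ if $w\beta^i\in R^{\epsilon_i}$ for all $i$ and all $w\in\mathcal F^{(\chi,J)}$. For a skew local region, $\mathbb H^{(\chi,J)}$ is the $\mathbb H$-module with basis $\{v_w:w\in\mathcal F^{(\chi,J)}\}$ and action $$p\,v_w=(w\chi)(p)\,v_w\quad(p\in V),\qquad t_{s_\alpha}v_w=\frac{c}{(w\chi)(\alpha)}v_w+\Bigl(1+\frac{c}{(w\chi)(\alpha)}\Bigr)v_{s_\alpha w}\quad(\alpha\in\Delta),$$ where $v_{s_\alpha w}=0$ if $s_\alpha w\notin\mathcal F^{(\chi,J)}$. An $\mathbb H$-module is a *discrete series* if it is irreducible and $\mathrm{Re}\,\chi'(\varpi_\alpha)<0$ for each of its weights $\chi'$ (the $\chi'\in V^\vee$ with non-zero generalized weight space) and each $\alpha\in\Delta$, where $\varpi_\alpha\in V_0$ is the fundamental weight, $\beta^\vee(\varpi_\alpha)=\delta_{\alpha\beta}$ for $\beta\in\Delta$. **Theorem.** For each $j\in\{13,14,15\}$ there is a unique $\chi_j\in V^\vee$ with $Z(\chi_j)$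 and $P(\chi_j)=\{\beta_j^1,\dots,\beta_j^6\}$ as follows: - $Z(\chi_{13})=\{\alpha_4\}$; $\beta_{13}^1=\sqrt2(0,1,0,0)$, $\beta_{13}^2=\sqrt2(a,\frac12,b,0)$, $\beta_{13}^3=\sqrt2(-a,0,\frac12,b)$, $\beta_{13}^4=\sqrt2(0,-\frac12,a,b)$, $\beta_{13}^5=\sqrt2(-\frac12,-\frac12,-\frac12,\frac12)$, $\beta_{13}^6=\sqrt2(0,-a,-b,\frac12)$; - $Z(\chi_{14})=\{\alpha_4\}$; $\beta_{14}^1=\sqrt2(-b,a,\frac12,0)$, $\beta_{14}^2=\sqrt2(\frac12,b,a,0)$, $\beta_{14}^3=\sqrt2(b,a,-\frac12,0)$, $\beta_{14}^4=\sqrt2(a,\frac12,-b,0)$, $\beta_{14}^5=\sqrt2(-a,0,-\frac12,b)$, $\beta_{14}^6=\sqrt2(\frac12,-a,0,b)$; - $Z(\chi_{15})=\{\alpha_2\}$; $\beta_{15}^1=\sqrt2(-\frac12,-a,0,b)$, $\beta_{15}^2=\sqrt2(0,-\frac12,-a,b)$, $\beta_{15}^3=\sqrt2(\frac12,-b,a,0)$,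 $\beta_{15}^4=\sqrt2(1,0,0,0)$, $\beta_{15}^5=\sqrt2(-\frac12,b,a,0)$, $\beta_{15}^6=\sqrt2(b,a,-\frac12,0)$. Moreover, there is $J_j\subseteq P(\chi_j)$ such that $(\chi_j,J_j)$ is a skew local region and $\mathcal F^{(\chi_j,J_j)}$ has the sign $(-,-,-,+,-,+)$ for $j=13$, $(-,+,-,+,-,-)$ for $j=14$, and $(-,+,-,+,-,-)$ for $j=15$. The above formulas define an $\mathbb H$-module $\mathbb H^{(\chi_j,J_j)}$, and it is a discrete series, of dimension $81$, $10$, $9$ for $j=13,14,15$ respectively. -/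

import Mathlib

open scoped TensorProduct NNReal

noncomputable section

namespace GradedHecke

section General

variable {E : Type*} [NormedAddCommGroup E] [InnerProductSpace ℝ E]

/-- The coroot `α^∨ = 2⟨α, ·⟩ / ⟨α, α⟩`, a linear functional on `V₀ = E`. -/
def coroot (α : E) : Module.Dual ℝ E := (2 / inner ℝ α α : ℝ) • innerₛₗ ℝ α

/-- The orthogonal reflection `s_α`, see `refl_apply`. -/
def refl (α : E) : E ≃ₗᵢ[ℝ] E := (ℝ ∙ α)ᗮ.reflection

theorem refl_apply (α v : E) : refl α v = v - coroot α v • α := by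
  rw [refl, Submodule.reflection_orthogonal_apply, Submodule.reflection_singleton_apply]
  simp only [coroot, LinearMap.smul_apply, innerₛₗ_apply_apply, smul_eq_mul, neg_sub,
    real_inner_self_eq_norm_sq, RCLike.ofReal_real_eq_id, id_eq, two_smul, ← add_smul]
  congr 2
  ring

/-- The reflection group `W` generated by the `s_α`, `α ∈ R`. -/
def weylGroup (R : Set E) : Subgroup (E ≃ₗᵢ[ℝ] E) := Subgroup.closure (refl '' R)

/-- The reflection `s_α` as an element of `W`. -/
def weylRefl (R : Set E) (α : R) : weylGroup R :=
  ⟨refl (α : E), Subgroup.subset_closure ⟨α, α.2, rfl⟩⟩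

/-- The complexification `V = ℂ ⊗ V₀`. -/
abbrev Cplx (E : Type*) [NormedAddCommGroup E] [InnerProductSpace ℝ E] : Type _ := ℂ ⊗[ℝ] E

/-- The characters of `V`, i.e. the elements of `V^∨`. -/
abbrev Character (E : Type*) [NormedAddCommGroup E] [InnerProductSpace ℝ E] : Type _ :=
  Module.Dual ℂ (Cplx E)

/-- The complex linear extension to `V` of an isometry of `V₀`. -/
def cplxMap (w : E ≃ₗᵢ[ℝ] E) : Cplx E →ₗ[ℂ] Cplx E :=
  (w.toLinearEquiv : E →ₗ[ℝ] E).baseChange ℂ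

/-- The complex linear extension of `α^∨` to `V`. -/
def cplxCoroot (α : E) : Character E := (coroot α).baseChange ℂ

/-- `(w χ)(v) = χ(w⁻¹ v)`. -/
def act (w : E ≃ₗᵢ[ℝ] E) (χ : Character E) : Character E := χ ∘ₗ cplxMap w⁻¹

/-- The value `χ(v)` at an element `v` of `V₀ ⊆ V`. -/
def ev (χ : Character E) (v : E) : ℂ := χ (1 ⊗ₜ[ℝ] v)

/-- `R⁺`: the roots that are non-negative combinations of simple roots. -/
def posRoots (R Δ : Set E) : Set E := {α | α ∈ R ∧ α ∈ Submodule.span ℝ≥0 Δ}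

/-- `R⁻`: the roots that are non-positive combinations of simple roots. -/
def negRoots (R Δ : Set E) : Set E := {α | α ∈ R ∧ -α ∈ Submodule.span ℝ≥0 Δ}

/-! ### The graded Hecke algebra -/

/-- The generating symbols `t_w` (`w ∈ W`) and `f_v` (`v ∈ V`). -/
inductive Gen (R : Set E) : Type _
  | t (w : weylGroup R) : Gen R
  | f (v : Cplx E) : Gen R

/-- `t_w` in the free algebra. -/
def preT {R : Set E} (w : weylGroup R) : FreeAlgebra ℂ (Gen R) := FreeAlgebra.ι ℂ (Gen.t w)

/-- `f_v` in the free algebra. -/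
def preF (R : Set E) (v : Cplx E) : FreeAlgebra ℂ (Gen R) := FreeAlgebra.ι ℂ (Gen.f v)

/-- The defining relations: `w ↦ t_w` extends to an algebra map on `ℂ[W]`, `v ↦ f_v` extends to an
algebra map on `S(V)`, and `t_{s_α} v - s_α(v) t_{s_α} = c_α ⟨v, α^∨⟩` for simple `α`. -/
inductive Rel (R Δ : Set E) (c : E → ℂ) : FreeAlgebra ℂ (Gen R) → FreeAlgebra ℂ (Gen R) → Prop
  | t_one : Rel R Δ c (preT 1) 1
  | t_mul (w w' : weylGroup R) : Rel R Δ c (preT (w * w')) (preT w * preT w')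
  | f_add (v v' : Cplx E) : Rel R Δ c (preF R (v + v')) (preF R v + preF R v')
  | f_smul (z : ℂ) (v : Cplx E) : Rel R Δ c (preF R (z • v)) (z • preF R v)
  | f_comm (v v' : Cplx E) : Rel R Δ c (preF R v * preF R v') (preF R v' * preF R v)
  | cross (α : R) (hα : (α : E) ∈ Δ) (v : Cplx E) :
      Rel R Δ c
        (preT (weylRefl R α) * preF R v - preF R (cplxMap (refl (α : E)) v) * preT (weylRefl R α))
        (algebraMap ℂ _ (c α * cplxCoroot (α : E) v))

/-- The graded Hecke algebra `ℍ(V, R, Δ, c)`. -/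
abbrev Hecke (R Δ : Set E) (c : E → ℂ) : Type _ := RingQuot (Rel R Δ c)

/-- The element `t_w` of `ℍ`. -/
def Hecke.t {R : Set E} (Δ : Set E) (c : E → ℂ) (w : weylGroup R) : Hecke R Δ c :=
  RingQuot.mkAlgHom ℂ (Rel R Δ c) (preT w)

/-- The element `v` of `V ⊆ S(V) ⊆ ℍ`. -/
def Hecke.f (R Δ : Set E) (c : E → ℂ) (v : Cplx E) : Hecke R Δ c :=
  RingQuot.mkAlgHom ℂ (Rel R Δ c) (preF R v)

/-! ### Modules, given as algebra maps `ℍ → End_ℂ(M)` -/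

section Modules

variable {R Δ : Set E} {c : E → ℂ} {M : Type*} [AddCommGroup M] [Module ℂ M]

/-- `M` is an irreducible `ℍ`-module. -/
def IsIrreducible (ρ : Hecke R Δ c →ₐ[ℂ] Module.End ℂ M) : Prop :=
  Nontrivial M ∧
    ∀ N : Submodule ℂ M, (∀ h : Hecke R Δ c, ∀ m ∈ N, ρ h m ∈ N) → N = ⊥ ∨ N = ⊤

/-- `χ` is a weight of `M`: the generalized `χ`-weight space of `M` is non-zero. -/
def IsWeight (ρ : Hecke R Δ c →ₐ[ℂ] Module.End ℂ M) (χ : Character E) : Prop :=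
  ∃ m : M, m ≠ 0 ∧ ∀ v : Cplx E, ∃ k : ℕ,
    ((ρ (Hecke.f R Δ c v) - algebraMap ℂ (Module.End ℂ M) (χ v)) ^ k) m = 0

/-- `ϖ` is the fundamental weight attached to the simple root `α`. -/
def IsFundamentalWeight (Δ : Set E) (α ϖ : E) : Prop :=
  coroot α ϖ = 1 ∧ ∀ β ∈ Δ, β ≠ α → coroot β ϖ = 0

/-- Discrete series, for `Δ` a basis of `V₀` (then `ϖ` below exists and is unique):
an irreducible module with `Re χ(ϖ_α) < 0` for all weights `χ` and all simple roots `α`. -/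
def IsDiscreteSeries (ρ : Hecke R Δ c →ₐ[ℂ] Module.End ℂ M) : Prop :=
  IsIrreducible ρ ∧
    ∀ χ : Character E, IsWeight ρ χ →
      ∀ α ∈ Δ, ∃ ϖ : E, IsFundamentalWeight Δ α ϖ ∧ (ev χ ϖ).re < 0

end Modules

/-! ### Local regions -/

/-- `Z(χ) = {α ∈ R⁺ : χ(α) = 0}`. -/
def zeroSet (R Δ : Set E) (χ : Character E) : Set E := {α | α ∈ posRoots R Δ ∧ ev χ α = 0}

/-- `P(χ) = {α ∈ R : χ(α) = c_α}`. -/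
def paramSet (R : Set E) (c : E → ℂ) (χ : Character E) : Set E := {α | α ∈ R ∧ ev χ α = c α}

/-- The inversion set `R(w) = {α ∈ R⁺ : w α ∈ R⁻}`. -/
def inversionSet (R Δ : Set E) (w : weylGroup R) : Set E :=
  {α | α ∈ posRoots R Δ ∧ (w : E ≃ₗᵢ[ℝ] E) α ∈ negRoots R Δ}

/-- The set `ℱ^{(χ, J)}` of elements of `W`. -/
def region (R Δ : Set E) (c : E → ℂ) (χ : Character E) (J : Set E) : Set (weylGroup R) :=
  {w | inversionSet R Δ w ∩ zeroSet R Δ χ = ∅ ∧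
    (∀ β ∈ J, (w : E ≃ₗᵢ[ℝ] E) β ∈ negRoots R Δ) ∧
    ∀ β ∈ paramSet R c χ \ J, (w : E ≃ₗᵢ[ℝ] E) β ∈ posRoots R Δ}

/-- `(χ, J)` is a local region. -/
def IsLocalRegion (R Δ : Set E) (c : E → ℂ) (χ : Character E) (J : Set E) : Prop :=
  J ⊆ paramSet R c χ ∧ (region R Δ c χ J).Nonempty

/-- The rank two subroot system `R_{αβ}`: the roots in the span of `α` and `β`. -/
def rankTwo (R : Set E) (α β : E) : Set E := {γ | γ ∈ R ∧ γ ∈ Submodule.span ℝ {α, β}}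

/-- `(χ, J)` is a skew local region. -/
def IsSkewLocalRegion (R Δ : Set E) (c : E → ℂ) (χ : Character E) (J : Set E) : Prop :=
  IsLocalRegion R Δ c χ J ∧
  (∀ γ ∈ Δ, ∀ w ∈ region R Δ c χ J, ev (act (w : E ≃ₗᵢ[ℝ] E) χ) γ ≠ 0) ∧
  ∀ α ∈ Δ, ∀ β ∈ Δ, α ≠ β → ∀ w ∈ region R Δ c χ J,
    {γ | γ ∈ rankTwo R α β ∧ ev (act (w : E ≃ₗᵢ[ℝ] E) χ) γ = 0}.Nonempty →
    2 < {γ | γ ∈ rankTwo R α β ∧ (ev (act (w : E ≃ₗᵢ[ℝ] E) χ) γ = c γ ∨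
      ev (act (w : E ≃ₗᵢ[ℝ] E) χ) γ = -c γ)}.encard

open Classical in
/-- The sign of a root: `1` on `R⁺` and `-1` on `R⁻`. -/
def rootSign (R Δ : Set E) (γ : E) : SignType :=
  if γ ∈ posRoots R Δ then 1 else if γ ∈ negRoots R Δ then -1 else 0

/-- `ℱ^{(χ, J)}` has the sign `ε`, with respect to the ordering `β` of `P(χ)`. -/
def HasSign (R Δ : Set E) (c : E → ℂ) (χ : Character E) (J : Set E) {r : ℕ}
    (β : Fin r → E) (ε : Fin r → SignType) : Prop :=
  ∀ w ∈ region R Δ c χ J, ∀ i, rootSign R Δ ((w : E ≃ₗᵢ[ℝ] E) (β i)) = ε i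

/-- The vector space underlying `ℍ^{(χ, J)}`, with basis `v_w`, `w ∈ ℱ^{(χ, J)}`. -/
abbrev CalSpace (R Δ : Set E) (c : E → ℂ) (χ : Character E) (J : Set E) : Type _ :=
  region R Δ c χ J →₀ ℂ

open Classical in
/-- The vector `v_w`, which is `0` when `w ∉ ℱ^{(χ, J)}`. -/
def basisVec (R Δ : Set E) (c : E → ℂ) (χ : Character E) (J : Set E) (w : weylGroup R) :
    CalSpace R Δ c χ J :=
  if h : w ∈ region R Δ c χ J then Finsupp.single ⟨w, h⟩ 1 else 0

/-- `ρ` is the module structure of `ℍ^{(χ, J)}`: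
`p v_w = (wχ)(p) v_w` for `p ∈ V`, and
`t_α v_w = c_α / (wχ)(α) v_w + (1 + c_α / (wχ)(α)) v_{s_α w}` for `α ∈ Δ`.
(As `ℍ` is generated by `V` and the `t_α`, there is at most one such structure.) -/
def IsCalibratedAction (R Δ : Set E) (c : E → ℂ) (χ : Character E) (J : Set E)
    (ρ : Hecke R Δ c →ₐ[ℂ] Module.End ℂ (CalSpace R Δ c χ J)) : Prop :=
  ∀ w ∈ region R Δ c χ J,
    (∀ p : Cplx E, ρ (Hecke.f R Δ c p) (basisVec R Δ c χ J w) =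
      act (w : E ≃ₗᵢ[ℝ] E) χ p • basisVec R Δ c χ J w) ∧
    ∀ α : R, (α : E) ∈ Δ →
      ρ (Hecke.t Δ c (weylRefl R α)) (basisVec R Δ c χ J w) =
        (c α / ev (act (w : E ≃ₗᵢ[ℝ] E) χ) α) • basisVec R Δ c χ J w +
        (1 + c α / ev (act (w : E ≃ₗᵢ[ℝ] E) χ) α) • basisVec R Δ c χ J (weylRefl R α * w)

end General

/-! ### Type `H₄` -/

/-- `ℝ⁴` with its standard inner product. -/
abbrev E4 : Type := EuclideanSpace ℝ (Fin 4)

/-- `a = (√5 + 1) / 4`. -/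
def ca : ℝ := (√5 + 1) / 4

/-- `b = (√5 - 1) / 4`. -/
def cb : ℝ := (√5 - 1) / 4

/-- The vector `√2 (x, y, z, w)`. -/
def vec (x y z w : ℝ) : E4 := √2 • !₂[x, y, z, w]

/-- The roots of `H₄`: the vectors obtained from `√2(1,0,0,0)`, `√2(1/2,1/2,1/2,1/2)` and
`√2(a,1/2,b,0)` by even permutations of the coordinates and arbitrary sign changes. -/
def rootsH4 : Set E4 :=
  {v | ∃ u ∈ ({vec 1 0 0 0, vec (1/2) (1/2) (1/2) (1/2), vec ca (1/2) cb 0} : Set E4),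
    ∃ σ ∈ alternatingGroup (Fin 4), ∃ e : Fin 4 → ℤˣ, ∀ i, v i = ((e i : ℤ) : ℝ) * u (σ i)}

/-- The simple roots `α₁, α₂, α₃, α₄`. -/
def simpleH4 : Fin 4 → E4 :=
  ![vec (-1/2) (-ca) 0 cb, vec (1/2) cb (-ca) 0, vec (-ca) (1/2) cb 0, vec ca (-1/2) cb 0]

/-- The set `Δ` of simple roots. -/
def deltaH4 : Set E4 := Set.range simpleH4

/-- The simple roots are roots. -/
theorem deltaH4_subset : deltaH4 ⊆ rootsH4 := by
  rintro _ ⟨i, rfl⟩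
  refine ⟨vec ca (1/2) cb 0, by simp, ?_⟩
  fin_cases i
  · refine ⟨Equiv.swap 0 1 * Equiv.swap 2 3, Equiv.Perm.mem_alternatingGroup.2 (by decide), ![-1, -1, 1, 1], fun k => ?_⟩
    fin_cases k <;> simp [simpleH4, vec, Equiv.swap_apply_def, neg_div]
  · refine ⟨Equiv.swap 0 1 * Equiv.swap 1 2, Equiv.Perm.mem_alternatingGroup.2 (by decide), ![1, 1, -1, 1], fun k => ?_⟩
    fin_cases k <;> simp [simpleH4, vec, Equiv.swap_apply_def, neg_div]
  · refine ⟨1, by simp, ![-1, 1, 1, 1], fun k => ?_⟩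
    fin_cases k <;> simp [simpleH4, vec, neg_div]
  · refine ⟨1, by simp, ![1, -1, 1, 1], fun k => ?_⟩
    fin_cases k <;> simp [simpleH4, vec, neg_div]

/-- The parameter function `c ≡ 1/2`. -/
def paramH4 : E4 → ℂ := fun _ => 1 / 2

/-- The element of `Z(χ_j)`, for `j = 13, 14, 15` in this order. -/
def zRoot : Fin 3 → E4 := ![simpleH4 3, simpleH4 3, simpleH4 1]

/-- The elements `β_j^1, …, β_j^6` of `P(χ_j)`, for `j = 13, 14, 15` in this order. -/
def pRoots : Fin 3 → Fin 6 → E4 :=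
  ![![vec 0 1 0 0, vec ca (1/2) cb 0, vec (-ca) 0 (1/2) cb, vec 0 (-1/2) ca cb,
      vec (-1/2) (-1/2) (-1/2) (1/2), vec 0 (-ca) (-cb) (1/2)],
    ![vec (-cb) ca (1/2) 0, vec (1/2) cb ca 0, vec cb ca (-1/2) 0, vec ca (1/2) (-cb) 0,
      vec (-ca) 0 (-1/2) cb, vec (1/2) (-ca) 0 cb],
    ![vec (-1/2) (-ca) 0 cb, vec 0 (-1/2) (-ca) cb, vec (1/2) (-cb) ca 0, vec 1 0 0 0,
      vec (-1/2) cb ca 0, vec cb ca (-1/2) 0]]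

/-- The prescribed sign of the local region, for `j = 13, 14, 15` in this order. -/
def signs : Fin 3 → Fin 6 → SignType :=
  ![![-1, -1, -1, 1, -1, 1], ![-1, 1, -1, 1, -1, -1], ![-1, 1, -1, 1, -1, -1]]

/-- The dimensions, for `j = 13, 14, 15` in this order. -/
def dims : Fin 3 → ℕ := ![81, 10, 9]

end GradedHecke

end

/-! The character is pinned down by linear algebra: the root of `Z(χ_j)` together with `β_j^1`,
`β_j^3`, `β_j^5` is a basis over `ℤ[φ]` of the span of the simple roots, with `φ` the golden ratio.
The prescribed sets therefore force the values of `2χ_j` at the simple roots to be `twoChi j`, and a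
finite check shows that these values give exactly the sets required.

The region is then enumerated. For `w` in it, `s_i w` is again in it precisely when `(wχ)(α_i)` is
none of `0, c, -c` (`gen_mul_mem_region_iff`), and any two elements are joined by such steps
(`region_induction`). Hence a list containing one element and closed under these steps is the whole
region. An element is recorded by the images of the simple roots under its inverse, so its weight
`2wχ` has coordinates in `ℤ[φ]`, where equality is decidable because `φ` is irrational. One kernel
computation, `codes_spec`, supplies all facts about the 81, 10 and 9 weights: they are distinct,
negative on the fundamental weights, and nonzero on every root supported on at most two simple
roots. The last fact gives the first skewness condition and makes the second one vacuous.

To obtain the module, Matsumoto's theorem (`map_prod_eq_of_reduced`) reduces the action of `W` to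
quadratic and braid relations. The quadratic and cross relations are short identities
(`reflOp_mul_self`, `reflOp_cross`). The braid relations are not derived from skewness but checked
on each basis vector by exact arithmetic, after clearing denominators (`braid_of_lt`).

Since the weights are distinct, a nonzero submodule contains some `v_w`; connectedness of the region
then yields every basis vector, so the module is irreducible. Its only weights are the `wχ`, whose
signs were checked. -/

open scoped TensorProduct NNReal

namespace GradedHecke

/-! ### Simple systems, the length function and reduced words -/

section General

variable {E : Type*} [NormedAddCommGroup E] [InnerProductSpace ℝ E] {ι : Type*}

@[simp]
theorem ev_act (w : E ≃ₗᵢ[ℝ] E) (χ : Character E) (v : E) : ev (act w χ) v = ev χ (w⁻¹ v) := by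
  simp [ev, act, cplxMap]

theorem ev_neg (χ : Character E) (v : E) : ev χ (-v) = -ev χ v := by
  simp [ev, TensorProduct.tmul_neg]

theorem ev_add (χ : Character E) (v v' : E) : ev χ (v + v') = ev χ v + ev χ v' := by
  simp [ev, TensorProduct.tmul_add]

theorem ev_smul (χ : Character E) (r : ℝ) (v : E) : ev χ (r • v) = r * ev χ v := by
  rw [ev, TensorProduct.tmul_smul, ← algebraMap_smul ℂ r, map_smul]
  simp [ev]

theorem ev_sum {κ : Type*} (χ : Character E) (s : Finset κ) (v : κ → E) :
    ev χ (∑ k ∈ s, v k) = ∑ k ∈ s, ev χ (v k) := by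
  simp [ev, TensorProduct.tmul_sum]

theorem Character.ext_of_ev {χ χ' : Character E} (h : ∀ v, ev χ v = ev χ' v) : χ = χ' := by
  ext v
  exact h v

theorem refl_mul_self (α : E) : refl α * refl α = 1 := by
  ext v
  simp [refl]

theorem refl_refl (α v : E) : refl α (refl α v) = v := by
  simp [refl]

theorem refl_inv (α : E) : (refl α)⁻¹ = refl α :=
  inv_eq_of_mul_eq_one_left (refl_mul_self α)

theorem refl_self (α : E) : refl α α = -α :=
  Submodule.reflection_orthogonalComplement_singleton_eq_neg α

/-- `s` is a system of simple roots of the finite root system `R`, without diagram automorphisms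
realised in the Weyl group (`rigid`). -/
structure IsSimpleSystem (R : Set E) (s : ι → E) : Prop where
  finite : R.Finite
  mem : ∀ i, s i ∈ R
  neg_mem : ∀ γ ∈ R, -γ ∈ R
  refl_mem : ∀ α ∈ R, ∀ γ ∈ R, refl α γ ∈ R
  pos_or_neg : ∀ γ ∈ R, γ ∈ posRoots R (Set.range s) ∨ γ ∈ negRoots R (Set.range s)
  not_neg : ∀ γ ∈ posRoots R (Set.range s), γ ∉ negRoots R (Set.range s)
  refl_pos : ∀ i, ∀ γ ∈ posRoots R (Set.range s), γ ≠ s i →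
    refl (s i) γ ∈ posRoots R (Set.range s)
  rigid : ∀ u ∈ weylGroup R, (∀ i, u (s i) ∈ posRoots R (Set.range s)) → u = 1

/-- The number of positive roots made negative by `w⁻¹`. -/
noncomputable def invCount (R : Set E) (s : ι → E) (w : weylGroup R) : ℕ :=
  (inversionSet R (Set.range s) w⁻¹).ncard

namespace IsSimpleSystem

variable {R : Set E} {s : ι → E} (hs : IsSimpleSystem R s)

/-- The simple reflection `s_i` as an element of `W`. -/
noncomputable def gen (i : ι) : weylGroup R := weylRefl R ⟨s i, hs.mem i⟩

@[simp]
theorem coe_gen (i : ι) : ((hs.gen i : weylGroup R) : E ≃ₗᵢ[ℝ] E) = refl (s i) := rfl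

@[simp]
theorem gen_mul_self (i : ι) : hs.gen i * hs.gen i = 1 :=
  Subtype.ext (refl_mul_self _)

theorem gen_inv (i : ι) : (hs.gen i)⁻¹ = hs.gen i :=
  inv_eq_of_mul_eq_one_left (hs.gen_mul_self i)

@[simp]
theorem gen_mul_gen_mul (i : ι) (w : weylGroup R) : hs.gen i * (hs.gen i * w) = w := by
  rw [← mul_assoc, gen_mul_self, one_mul]

theorem coe_gen_mul_inv_apply (i : ι) (w : weylGroup R) (v : E) :
    ((hs.gen i * w : weylGroup R) : E ≃ₗᵢ[ℝ] E)⁻¹ v = (w : E ≃ₗᵢ[ℝ] E)⁻¹ (refl (s i) v) := by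
  rw [Subgroup.coe_mul, mul_inv_rev, coe_gen, refl_inv]
  rfl

include hs

theorem apply_mem (w : weylGroup R) : ∀ γ ∈ R, (w : E ≃ₗᵢ[ℝ] E) γ ∈ R := by
  obtain ⟨w, hw⟩ := w
  refine Subgroup.closure_induction (p := fun w _ => ∀ γ ∈ R, w γ ∈ R) ?_ ?_ ?_ ?_ hw
  · rintro _ ⟨α, hα, rfl⟩ γ hγ
    exact hs.refl_mem α hα γ hγ
  · intro γ hγ
    exact hγ
  · intro x y _ _ hx hy γ hγ
    exact hx _ (hy _ hγ)
  · intro x _ hx γ hγ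
    -- An injective self-map of the finite set `R` is onto, so the inverse preserves `R` as well.
    have : Set.BijOn x R R := (Set.Finite.injOn_iff_bijOn_of_mapsTo hs.finite hx).1
      x.injective.injOn
    obtain ⟨δ, hδ, rfl⟩ := this.surjOn hγ
    simpa using hδ

theorem neg_mem_negRoots {γ : E} (h : γ ∈ posRoots R (Set.range s)) :
    -γ ∈ negRoots R (Set.range s) :=
  ⟨hs.neg_mem _ h.1, by simpa using h.2⟩

theorem neg_mem_posRoots {γ : E} (h : γ ∈ negRoots R (Set.range s)) :
    -γ ∈ posRoots R (Set.range s) :=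
  ⟨hs.neg_mem _ h.1, h.2⟩

theorem mem_negRoots_of_neg {γ : E} (h : -γ ∈ posRoots R (Set.range s)) :
    γ ∈ negRoots R (Set.range s) := by
  simpa using hs.neg_mem_negRoots h

theorem simple_pos (i : ι) : s i ∈ posRoots R (Set.range s) :=
  ⟨hs.mem i, Submodule.subset_span ⟨i, rfl⟩⟩

theorem inv_apply_mem (w : weylGroup R) {γ : E} (h : γ ∈ R) : (w : E ≃ₗᵢ[ℝ] E)⁻¹ γ ∈ R :=
  hs.apply_mem w⁻¹ γ h

/-- A root which is not sent to a simple root or its negative is not affected by a simple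
reflection. -/
theorem refl_neg {i : ι} {γ : E} (h : γ ∈ negRoots R (Set.range s)) (hne : γ ≠ -s i) :
    refl (s i) γ ∈ negRoots R (Set.range s) := by
  apply hs.mem_negRoots_of_neg
  rw [← map_neg]
  exact hs.refl_pos i _ (hs.neg_mem_posRoots h) fun h' => hne (by rw [← h', neg_neg])

/-- Since `s_i` permutes the positive roots other than `α_i`, the inversions of `(s_i w)⁻¹` are the
`s_i`-images of those of `w⁻¹`, together with the new root `α_i`. -/
theorem invCount_gen_mul_of_pos {w : weylGroup R} {i : ι}
    (h : (w : E ≃ₗᵢ[ℝ] E)⁻¹ (s i) ∈ posRoots R (Set.range s)) :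
    invCount R s (hs.gen i * w) = invCount R s w + 1 := by
  have key : inversionSet R (Set.range s) (hs.gen i * w)⁻¹ =
      insert (s i) (refl (s i) '' inversionSet R (Set.range s) w⁻¹) := by
    ext γ
    simp only [inversionSet, Set.mem_ofPred_eq, Set.mem_insert_iff, Set.mem_image,
      InvMemClass.coe_inv, hs.coe_gen_mul_inv_apply]
    constructor
    · rintro ⟨hγ, hn⟩
      by_cases hγi : γ = s i
      · exact Or.inl hγi
      · exact Or.inr ⟨_, ⟨hs.refl_pos i γ hγ hγi, hn⟩, refl_refl _ _⟩
    · rintro (rfl | ⟨δ, ⟨hδ, hn⟩, rfl⟩)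
      · refine ⟨hs.simple_pos i, ?_⟩
        rw [refl_self, map_neg]
        exact hs.neg_mem_negRoots h
      · refine ⟨hs.refl_pos i δ hδ ?_, by rwa [refl_refl]⟩
        rintro rfl
        exact hs.not_neg _ h hn
  have hfin : (inversionSet R (Set.range s) w⁻¹).Finite :=
    hs.finite.subset fun γ hγ => hγ.1.1
  rw [invCount, key, Set.ncard_insert_of_notMem _ (hfin.image _),
    Set.ncard_image_of_injective _ (refl (s i)).injective, invCount]
  rintro ⟨δ, ⟨hδ, -⟩, hδi⟩
  have : δ = -s i := by rw [← refl_self, ← refl_refl (s i) δ, hδi]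
  exact hs.not_neg _ hδ (this ▸ hs.neg_mem_negRoots (hs.simple_pos i))

theorem invCount_gen_mul_of_neg {w : weylGroup R} {i : ι}
    (h : (w : E ≃ₗᵢ[ℝ] E)⁻¹ (s i) ∈ negRoots R (Set.range s)) :
    invCount R s (hs.gen i * w) + 1 = invCount R s w := by
  rw [← hs.invCount_gen_mul_of_pos, gen_mul_gen_mul]
  have : (((hs.gen i * w : weylGroup R) : E ≃ₗᵢ[ℝ] E))⁻¹ (s i) =
      -((w : E ≃ₗᵢ[ℝ] E)⁻¹ (s i)) := by
    rw [coe_gen_mul_inv_apply, refl_self, map_neg]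
  rw [this]
  exact hs.neg_mem_posRoots h

/-- Otherwise `w⁻¹` keeps all simple roots positive and is trivial by `rigid`. This supplies the
descent for every induction on length. -/
theorem exists_inversion {w : weylGroup R} (hw : w ≠ 1) :
    ∃ i, (w : E ≃ₗᵢ[ℝ] E)⁻¹ (s i) ∈ negRoots R (Set.range s) := by
  by_contra! hcon
  apply hw
  have := hs.rigid _ (w⁻¹).2 fun i => (hs.pos_or_neg _ (hs.apply_mem w⁻¹ _ (hs.mem i))).resolve_right
    (hcon i)
  exact inv_eq_one.1 (Subtype.ext this)

/-- Induction on elements of `W` through left multiplication by simple reflections which increase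
the length. -/
theorem gen_induction {p : weylGroup R → Prop} (one : p 1)
    (mul : ∀ i (w : weylGroup R), (w : E ≃ₗᵢ[ℝ] E)⁻¹ (s i) ∈ posRoots R (Set.range s) → p w → p (hs.gen i * w))
    (w : weylGroup R) : p w := by
  induction hn : invCount R s w using Nat.strong_induction_on generalizing w with
  | _ n ih =>
    by_cases hw : w = 1
    · exact hw ▸ one
    obtain ⟨i, hi⟩ := hs.exists_inversion hw
    have hc := hs.invCount_gen_mul_of_neg hi
    rw [← hs.gen_mul_gen_mul i w]
    refine mul i _ ?_ (ih _ (by omega) _ rfl)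
    rw [coe_gen_mul_inv_apply, refl_self, map_neg]
    exact hs.neg_mem_posRoots hi

end IsSimpleSystem

/-! ### Extending maps defined on the simple reflections -/

/-- The alternating word `i, j, i, …` of length `k`. -/
def altWord : ℕ → ι → ι → List ι
  | 0, _, _ => []
  | k + 1, i, j => i :: altWord k j i

/-- The positive roots of the dihedral subsystem generated by `s i` and `s j`, in the order given
by the alternating word. -/
noncomputable def altRoot (s : ι → E) : ℕ → ι → ι → E
  | 0, i, _ => s i
  | k + 1, i, j => refl (s i) (altRoot s k j i)

/-- `m` satisfies the properties of the Coxeter matrix of the system `s` of simple roots. -/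
structure IsCoxeterMatrix (s : ι → E) (m : ι → ι → ℕ) : Prop where
  pos : ∀ i j, i ≠ j → 0 < m i j
  symm : ∀ i j, m i j = m j i
  braid : ∀ i j, i ≠ j → ((altWord (m i j) i j).map fun k => refl (s k)).prod =
    ((altWord (m i j) j i).map fun k => refl (s k)).prod
  cone : ∀ i j, i ≠ j → ∀ k < m i j, altRoot s k i j ∈ Submodule.span ℝ≥0 {s i, s j}

@[simp]
theorem length_altWord (k : ℕ) (i j : ι) : (altWord k i j).length = k := by
  induction k generalizing i j with
  | zero => rfl
  | succ k ih => simp [altWord, ih]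

namespace IsSimpleSystem

variable {R : Set E} {s : ι → E} (hs : IsSimpleSystem R s)

/-- The product in `W` of a word in the simple reflections. -/
noncomputable def wordProd (l : List ι) : weylGroup R := (l.map hs.gen).prod

@[simp]
theorem wordProd_nil : hs.wordProd [] = 1 := rfl

@[simp]
theorem wordProd_cons (i : ι) (l : List ι) : hs.wordProd (i :: l) = hs.gen i * hs.wordProd l := rfl

theorem wordProd_append (l l' : List ι) :
    hs.wordProd (l ++ l') = hs.wordProd l * hs.wordProd l' := by
  simp [wordProd]

theorem coe_wordProd (l : List ι) :
    (hs.wordProd l : E ≃ₗᵢ[ℝ] E) = (l.map fun k => refl (s k)).prod := by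
  induction l with
  | nil => rfl
  | cons i l ih => simp [ih]

/-- A word is reduced if its length is the length of its product. -/
def Reduced (l : List ι) : Prop := invCount R s (hs.wordProd l) = l.length

include hs in
theorem invCount_one : invCount R s 1 = 0 := by
  have : inversionSet R (Set.range s) (1 : weylGroup R)⁻¹ = ∅ := by
    ext γ
    simp only [inversionSet, inv_one, Set.mem_ofPred_eq, Set.mem_empty_iff_false, iff_false, not_and]
    exact fun h => hs.not_neg γ h
  rw [invCount, this, Set.ncard_empty]

include hs in
theorem inv_apply_pos_or_neg (w : weylGroup R) (i : ι) :
    (w : E ≃ₗᵢ[ℝ] E)⁻¹ (s i) ∈ posRoots R (Set.range s) ∨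
      (w : E ≃ₗᵢ[ℝ] E)⁻¹ (s i) ∈ negRoots R (Set.range s) :=
  hs.pos_or_neg _ (hs.inv_apply_mem w (hs.mem i))

theorem invCount_wordProd_le (l : List ι) : invCount R s (hs.wordProd l) ≤ l.length := by
  induction l with
  | nil => simp [hs.invCount_one]
  | cons i l ih =>
    rcases hs.inv_apply_pos_or_neg (hs.wordProd l) i with h | h
    · simpa [hs.invCount_gen_mul_of_pos h] using ih
    · have := hs.invCount_gen_mul_of_neg h
      simp only [wordProd_cons, List.length_cons]
      omega

/-- A letter changes the length by exactly one, and the length of a product never exceeds that of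
the word. -/
theorem Reduced.of_cons {i : ι} {l : List ι} (h : hs.Reduced (i :: l)) : hs.Reduced l := by
  have h1 := hs.invCount_wordProd_le l
  have h2 : invCount R s (hs.gen i * hs.wordProd l) = l.length + 1 := h
  rcases hs.inv_apply_pos_or_neg (hs.wordProd l) i with h | h
  · rw [hs.invCount_gen_mul_of_pos h] at h2
    exact Nat.succ.inj h2
  · have := hs.invCount_gen_mul_of_neg h
    omega

/-- The first letter of a reduced word is a left descent: otherwise removing it would make the
element longer than the remaining word. -/
theorem Reduced.neg_of_cons {i : ι} {l : List ι} (h : hs.Reduced (i :: l)) :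
    (hs.wordProd (i :: l) : E ≃ₗᵢ[ℝ] E)⁻¹ (s i) ∈ negRoots R (Set.range s) := by
  refine (hs.inv_apply_pos_or_neg _ i).resolve_left fun h' => ?_
  have h1 := hs.invCount_gen_mul_of_pos h'
  rw [wordProd_cons, gen_mul_gen_mul] at h1
  have h2 := hs.invCount_wordProd_le l
  have h3 : invCount R s (hs.gen i * hs.wordProd l) = l.length + 1 := h
  omega

theorem exists_reduced (w : weylGroup R) : ∃ l, hs.Reduced l ∧ hs.wordProd l = w := by
  induction w using hs.gen_induction with
  | one => exact ⟨[], by simp [Reduced, hs.invCount_one], rfl⟩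
  | mul i w h ih =>
    obtain ⟨l, hl, rfl⟩ := ih
    refine ⟨i :: l, ?_, rfl⟩
    rw [Reduced, wordProd_cons, hs.invCount_gen_mul_of_pos h, hl, List.length_cons]

/-- Letters are stripped from the left one at a time; the `l`-th one shortens the element because
`w⁻¹` makes the `l`-th alternating root negative. -/
theorem invCount_altWord (k : ℕ) (i j : ι) (w : weylGroup R)
    (h : ∀ l < k, (w : E ≃ₗᵢ[ℝ] E)⁻¹ (altRoot s l i j) ∈ negRoots R (Set.range s)) :
    invCount R s ((hs.wordProd (altWord k i j))⁻¹ * w) + k = invCount R s w := by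
  induction k generalizing i j w with
  | zero => simp [altWord]
  | succ k ih =>
    have h0 := hs.invCount_gen_mul_of_neg (h 0 k.succ_pos)
    have := ih j i (hs.gen i * w) fun l hl => by
      rw [coe_gen_mul_inv_apply]
      exact h (l + 1) (by omega)
    rw [altWord, wordProd_cons, mul_inv_rev, gen_inv, mul_assoc]
    omega

include hs in
theorem neg_of_mem_cone {w : weylGroup R} {i j : ι} {γ : E} (hγ : γ ∈ R)
    (hi : (w : E ≃ₗᵢ[ℝ] E)⁻¹ (s i) ∈ negRoots R (Set.range s))
    (hj : (w : E ≃ₗᵢ[ℝ] E)⁻¹ (s j) ∈ negRoots R (Set.range s))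
    (h : γ ∈ Submodule.span ℝ≥0 {s i, s j}) :
    (w : E ≃ₗᵢ[ℝ] E)⁻¹ γ ∈ negRoots R (Set.range s) := by
  refine ⟨hs.inv_apply_mem w hγ, ?_⟩
  obtain ⟨a, b, rfl⟩ := Submodule.mem_span_pair.1 h
  have hsm : ∀ (a : ℝ≥0) (v : E), (w : E ≃ₗᵢ[ℝ] E)⁻¹ (a • v) = a • (w : E ≃ₗᵢ[ℝ] E)⁻¹ v :=
    fun a v => map_smul (w : E ≃ₗᵢ[ℝ] E)⁻¹ (a : ℝ) v
  rw [map_add, neg_add, hsm, hsm, ← smul_neg, ← smul_neg]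
  exact add_mem (Submodule.smul_mem _ _ hi.2) (Submodule.smul_mem _ _ hj.2)

include hs in
theorem altRoot_mem (k : ℕ) (i j : ι) : altRoot s k i j ∈ R := by
  induction k generalizing i j with
  | zero => exact hs.mem i
  | succ k ih => exact hs.refl_mem _ (hs.mem i) _ (ih j i)

variable {G : Type*} [Monoid G]

/-- Matsumoto's theorem: the product of a reduced word depends only on its image in `W`. -/
theorem map_prod_eq_of_reduced {m : ι → ι → ℕ} (hm : IsCoxeterMatrix s m) (f : ι → G)
    (hf : ∀ i j, i ≠ j →
      ((altWord (m i j) i j).map f).prod = ((altWord (m i j) j i).map f).prod)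
    {l l' : List ι} (hl : hs.Reduced l) (hl' : hs.Reduced l')
    (h : hs.wordProd l = hs.wordProd l') : (l.map f).prod = (l'.map f).prod := by
  induction hn : l.length using Nat.strong_induction_on generalizing l l' with
  | _ n ih =>
    have hlen : l.length = l'.length := by rw [← hl, ← hl', h]
    rcases l with _ | ⟨i, t⟩
    · rw [List.length_eq_zero_iff.1 hlen.symm]
    rcases l' with _ | ⟨j, t'⟩
    · simp at hlen
    simp only [List.length_cons] at hn hlen
    by_cases hij : i = j
    · subst hij
      simp only [List.map_cons, List.prod_cons]
      rw [ih t.length (by omega) (hl.of_cons) (hl'.of_cons) (by simpa using h) rfl]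
    have hi := hl.neg_of_cons
    have hj := hl'.neg_of_cons
    rw [← h] at hj
    set w := hs.wordProd (i :: t) with hw
    -- Both `i` and `j` are left descents of `w`, so `w⁻¹` makes the whole positive cone of `s i`,
    -- `s j` negative. Thus `w` factors, with lengths adding, as the alternating word of length `m i
    -- j` times a reduced word `r`; the alternating word may start with either letter.
    obtain ⟨r, hr, hrw⟩ := hs.exists_reduced ((hs.wordProd (altWord (m i j) i j))⁻¹ * w)
    have hcount := hs.invCount_altWord (m i j) i j w fun k hk =>
      hs.neg_of_mem_cone (hs.altRoot_mem k i j) hi hj (hm.cone i j hij k hk)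
    have hbr : hs.wordProd (altWord (m i j) i j) = hs.wordProd (altWord (m i j) j i) :=
      Subtype.ext (by simpa [coe_wordProd] using hm.braid i j hij)
    obtain ⟨k, hk⟩ : ∃ k, m i j = k + 1 := ⟨m i j - 1, by have := hm.pos i j hij; omega⟩
    have hprod : hs.wordProd (altWord (m i j) i j ++ r) = w := by
      rw [wordProd_append, hrw, mul_inv_cancel_left]
    have hprod' : hs.wordProd (altWord (m i j) j i ++ r) = w := by
      rw [wordProd_append, ← hbr, hrw, mul_inv_cancel_left]
    have hlw : invCount R s w = t.length + 1 := hl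
    rw [← hrw, hr, hlw] at hcount
    have red : hs.Reduced (altWord (m i j) i j ++ r) := by
      rw [Reduced, hprod, hlw, List.length_append, length_altWord]
      omega
    have red' : hs.Reduced (altWord (m i j) j i ++ r) := by
      rw [Reduced, hprod', hlw, List.length_append, length_altWord]
      omega
    -- These two reduced words share their first letter, so the induction hypothesis applies to the
    -- tails. The same holds for `e2`, and the braid relation in `G` links the two.
    have e1 : ((i :: t).map f).prod = ((altWord (m i j) i j ++ r).map f).prod := by
      rw [hk] at red hprod ⊢
      have := ih t.length (by omega) (l' := altWord k j i ++ r) hl.of_cons (Reduced.of_cons hs red)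
        ?_ rfl
      · rw [altWord, List.cons_append, List.map_cons, List.prod_cons, List.map_cons, List.prod_cons,
          this]
      rw [altWord, List.cons_append, wordProd_cons, hw, wordProd_cons] at hprod
      exact (mul_left_cancel hprod).symm
    have e2 : ((j :: t').map f).prod = ((altWord (m i j) j i ++ r).map f).prod := by
      rw [hk] at red' hprod' ⊢
      have := ih t'.length (by omega) (l' := altWord k i j ++ r) hl'.of_cons
        (Reduced.of_cons hs red') ?_ rfl
      · rw [altWord, List.cons_append, List.map_cons, List.prod_cons, List.map_cons, List.prod_cons,
          this]
      rw [h, altWord, List.cons_append, wordProd_cons, wordProd_cons] at hprod'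
      exact (mul_left_cancel hprod').symm
    rw [e1, e2, List.map_append, List.map_append, List.prod_append, List.prod_append, hf i j hij]

/-- The Weyl group is the Coxeter group with Coxeter matrix `m`: a map on the simple reflections
which respects the Coxeter relations extends to the Weyl group. -/
theorem exists_monoidHom {m : ι → ι → ℕ} (hm : IsCoxeterMatrix s m) (f : ι → G)
    (hsq : ∀ i, f i * f i = 1)
    (hf : ∀ i j, i ≠ j →
      ((altWord (m i j) i j).map f).prod = ((altWord (m i j) j i).map f).prod) :
    ∃ T : weylGroup R →* G, ∀ i, T (hs.gen i) = f i := by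
  -- `T` evaluates a chosen reduced word; by Matsumoto's theorem any other reduced word gives the
  -- same value.
  choose word hred hword using hs.exists_reduced
  let T : weylGroup R → G := fun w => ((word w).map f).prod
  have hT : ∀ l, hs.Reduced l → T (hs.wordProd l) = (l.map f).prod := fun l hl =>
    hs.map_prod_eq_of_reduced hm f hf (hred _) hl (hword _)
  have hgen_pos : ∀ i (w : weylGroup R), (w : E ≃ₗᵢ[ℝ] E)⁻¹ (s i) ∈ posRoots R (Set.range s) →
      T (hs.gen i * w) = f i * T w := by
    intro i w h
    have : hs.Reduced (i :: word w) := by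
      rw [Reduced, wordProd_cons, hword, hs.invCount_gen_mul_of_pos h, List.length_cons, ← hred,
        hword]
    simpa [hword] using hT _ this
  have hgen : ∀ i w, T (hs.gen i * w) = f i * T w := by
    intro i w
    rcases hs.inv_apply_pos_or_neg w i with h | h
    · exact hgen_pos i w h
    -- If `s_i` shortens `w`, it lengthens `s_i w`, and `f i * f i = 1` transfers the identity back.
    · have := hgen_pos i (hs.gen i * w) (by
        rw [coe_gen_mul_inv_apply, refl_self, map_neg]
        exact hs.neg_mem_posRoots h)
      rw [gen_mul_gen_mul] at this
      rw [this, ← mul_assoc, hsq, one_mul]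
  have hone : T 1 = 1 := by
    have := hT [] (by simp [Reduced, hs.invCount_one])
    simpa using this
  refine ⟨⟨⟨T, hone⟩, fun x y => ?_⟩, fun i => ?_⟩
  · change T (x * y) = T x * T y
    induction x using hs.gen_induction with
    | one => rw [one_mul, hone, one_mul]
    | mul i w _ ih => rw [mul_assoc, hgen, ih, hgen, mul_assoc]
  · have := hgen i 1
    rwa [mul_one, hone, mul_one] at this

end IsSimpleSystem
end General

/-! ### Simple steps inside a local region -/

section Calibrated

variable {E : Type*} [NormedAddCommGroup E] [InnerProductSpace ℝ E] {ι : Type*}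

theorem act_mul (w w' : E ≃ₗᵢ[ℝ] E) (χ : Character E) : act (w * w') χ = act w (act w' χ) :=
  Character.ext_of_ev fun v => by simp [mul_inv_rev]

theorem cplxMap_refl (α : E) (p : Cplx E) :
    cplxMap (refl α) p = p - cplxCoroot α p • ((1 : ℂ) ⊗ₜ[ℝ] α) := by
  induction p using TensorProduct.induction_on with
  | zero => simp
  | add x y hx hy => rw [map_add, hx, hy, map_add, add_smul]; abel
  | tmul z v =>
    have : cplxMap (refl α) (z ⊗ₜ[ℝ] v) = z ⊗ₜ[ℝ] refl α v := rfl
    rw [this, refl_apply, TensorProduct.tmul_sub, TensorProduct.tmul_smul]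
    congr 1
    rw [cplxCoroot, TensorProduct.smul_tmul', ← TensorProduct.smul_tmul']
    simp [TensorProduct.smul_tmul', mul_comm, Algebra.smul_def]

theorem cplxMap_refl_refl (α : E) (p : Cplx E) :
    cplxMap (refl α) (cplxMap (refl α) p) = p := by
  induction p using TensorProduct.induction_on with
  | zero => simp
  | add x y hx hy => rw [map_add, map_add, hx, hy]
  | tmul z v =>
    change z ⊗ₜ[ℝ] refl α (refl α v) = _
    rw [refl_refl]

namespace IsSimpleSystem

variable {R : Set E} {s : ι → E} (hs : IsSimpleSystem R s) {c : E → ℂ} {χ : Character E}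
  {J : Set E}

theorem coe_gen_mul_apply (i : ι) (w : weylGroup R) (v : E) :
    ((hs.gen i * w : weylGroup R) : E ≃ₗᵢ[ℝ] E) v = refl (s i) ((w : E ≃ₗᵢ[ℝ] E) v) := rfl

theorem coe_gen_mul (i : ι) (w : weylGroup R) :
    ((hs.gen i * w : weylGroup R) : E ≃ₗᵢ[ℝ] E) = refl (s i) * (w : E ≃ₗᵢ[ℝ] E) := rfl

include hs in
theorem pos_of_mem_zeroSet {w : weylGroup R} {γ : E} (hw : w ∈ region R (Set.range s) c χ J)
    (hγ : γ ∈ zeroSet R (Set.range s) χ) :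
    (w : E ≃ₗᵢ[ℝ] E) γ ∈ posRoots R (Set.range s) := by
  refine (hs.pos_or_neg _ (hs.apply_mem w γ hγ.1.1)).resolve_right fun h => ?_
  have : γ ∈ inversionSet R (Set.range s) w ∩ zeroSet R (Set.range s) χ := ⟨⟨hγ.1, h⟩, hγ⟩
  rwa [hw.1] at this

include hs in
/-- The value of `χ` at a root which separates two elements of the region. -/
theorem ev_ne_of_separated {u u' : weylGroup R} (hu : u ∈ region R (Set.range s) c χ J)
    (hu' : u' ∈ region R (Set.range s) c χ J) {γ : E} (hγ : γ ∈ R)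
    (h : (u : E ≃ₗᵢ[ℝ] E) γ ∈ posRoots R (Set.range s))
    (h' : (u' : E ≃ₗᵢ[ℝ] E) γ ∈ negRoots R (Set.range s)) :
    ev χ γ ≠ 0 ∧ ev χ γ ≠ c γ ∧ ev χ γ ≠ -c (-γ) := by
  have hn := hs.neg_mem_negRoots h
  have hn' := hs.neg_mem_posRoots h'
  rw [← map_neg] at hn hn'
  refine ⟨fun h0 => ?_, fun h0 => ?_, fun h0 => ?_⟩
  · rcases hs.pos_or_neg γ hγ with hp | hp
    · exact hs.not_neg _ (hs.pos_of_mem_zeroSet hu' ⟨hp, h0⟩) h'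
    · exact hs.not_neg _ (hs.pos_of_mem_zeroSet hu
        ⟨hs.neg_mem_posRoots hp, by rw [ev_neg, h0, neg_zero]⟩) hn
  · by_cases hJ : γ ∈ J
    · exact hs.not_neg _ h (hu.2.1 _ hJ)
    · exact hs.not_neg _ (hu'.2.2 _ ⟨⟨hγ, h0⟩, hJ⟩) h'
  · have hP : -γ ∈ paramSet R c χ := ⟨hs.neg_mem _ hγ, by rw [ev_neg, h0, neg_neg]⟩
    by_cases hJ : -γ ∈ J
    · exact hs.not_neg _ hn' (hu'.2.1 _ hJ)
    · exact hs.not_neg _ (hu.2.2 _ ⟨hP, hJ⟩) hn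

/-- When left multiplication by a simple reflection preserves the region. -/
theorem gen_mul_mem_region_iff (hJ : J ⊆ paramSet R c χ)
    (hc : ∀ (w : weylGroup R) γ, c ((w : E ≃ₗᵢ[ℝ] E) γ) = c γ) {w : weylGroup R}
    (hw : w ∈ region R (Set.range s) c χ J) (i : ι) :
    hs.gen i * w ∈ region R (Set.range s) c χ J ↔
      ev (act w χ) (s i) ≠ 0 ∧ ev (act w χ) (s i) ≠ c (s i) ∧ ev (act w χ) (s i) ≠ -c (s i) := by
  rw [ev_act]
  set γ := (w : E ≃ₗᵢ[ℝ] E)⁻¹ (s i) with hγ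
  have hwγ : (w : E ≃ₗᵢ[ℝ] E) γ = s i := (w : E ≃ₗᵢ[ℝ] E).apply_symm_apply (s i)
  have hcγ : c γ = c (s i) := by rw [← hc w γ, hwγ]
  have hcγ' : c (-γ) = c (s i) := by
    rw [← hc (hs.gen i * w) (-γ), coe_gen_mul_apply, map_neg, hwγ, map_neg, refl_self, neg_neg]
  constructor
  -- The root `γ = w⁻¹ α_i` separates `w` from `s_i w`, which excludes the three values.
  · intro h
    rw [← hcγ]
    nth_rw 4 [← neg_neg γ]
    have := hs.ev_ne_of_separated hw h (hs.inv_apply_mem w (hs.mem i))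
      (by rw [← hγ, hwγ]; exact hs.simple_pos i)
      (by rw [← hγ, coe_gen_mul_apply, hwγ, refl_self]; exact hs.neg_mem_negRoots (hs.simple_pos i))
    rw [← hγ] at this
    simpa [hcγ, hcγ'] using this
  -- Among all roots only `±α_i` change sign under `s_i`. A condition of the region could thus fail
  -- only at a root that `w` sends to `±α_i`, and such a root would give one of the excluded values.
  · rintro ⟨h0, h1, h2⟩
    refine ⟨?_, fun β hβ => ?_, fun β hβ => ?_⟩
    · rw [Set.eq_empty_iff_forall_notMem]
      rintro δ ⟨⟨-, hδ⟩, hδZ⟩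
      refine hs.not_neg _ (hs.refl_pos i _ (hs.pos_of_mem_zeroSet hw hδZ) fun h => h0 ?_) hδ
      rw [hγ, ← h, ← hδZ.2]
      exact congrArg _ ((w : E ≃ₗᵢ[ℝ] E).symm_apply_apply δ)
    · refine hs.refl_neg (hw.2.1 β hβ) fun h => h2 ?_
      have : β = -γ := (w : E ≃ₗᵢ[ℝ] E).injective (by
        rw [map_neg, hwγ]
        exact h)
      rw [← hcγ', ← this, ← (hJ hβ).2, this, ev_neg, neg_neg]
    · refine hs.refl_pos i _ (hw.2.2 β hβ) fun h => h1 ?_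
      have : β = γ := (w : E ≃ₗᵢ[ℝ] E).injective (by
        rw [hwγ]
        exact h)
      rw [← hcγ, ← this, hβ.1.2]

/-- A region is connected under left multiplication by simple reflections. -/
theorem region_induction (hJ : J ⊆ paramSet R c χ)
    (hc : ∀ (w : weylGroup R) γ, c ((w : E ≃ₗᵢ[ℝ] E) γ) = c γ) {p : weylGroup R → Prop}
    {w w' : weylGroup R} (hw : w ∈ region R (Set.range s) c χ J)
    (hw' : w' ∈ region R (Set.range s) c χ J) (base : p w)
    (step : ∀ u ∈ region R (Set.range s) c χ J, p u → ∀ i,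
      hs.gen i * u ∈ region R (Set.range s) c χ J → p (hs.gen i * u)) : p w' := by
  induction hn : invCount R s (w * w'⁻¹) using Nat.strong_induction_on generalizing w with
  | _ n ih =>
    by_cases h1 : w * w'⁻¹ = 1
    · rwa [← mul_inv_eq_one.1 h1]
    -- A descent `i` of `w * w'⁻¹` yields the root `w⁻¹ α_i`, positive at `w` and negative at `w'`.
    -- As it separates two elements of the region, `s_i w` stays in the region and is closer to
    -- `w'`.
    obtain ⟨i, hi⟩ := hs.exists_inversion h1
    have hcount := hs.invCount_gen_mul_of_neg hi
    have hww : (w : E ≃ₗᵢ[ℝ] E) ((w : E ≃ₗᵢ[ℝ] E)⁻¹ (s i)) = s i :=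
      (w : E ≃ₗᵢ[ℝ] E).apply_symm_apply (s i)
    have hneg : (w' : E ≃ₗᵢ[ℝ] E) ((w : E ≃ₗᵢ[ℝ] E)⁻¹ (s i)) ∈ negRoots R (Set.range s) := by
      rw [Subgroup.coe_mul, mul_inv_rev, InvMemClass.coe_inv, inv_inv] at hi
      exact hi
    obtain ⟨h0, h1, h2⟩ := hs.ev_ne_of_separated hw hw' (hs.inv_apply_mem w (hs.mem i))
      (by rw [hww]; exact hs.simple_pos i) hneg
    have hmem : hs.gen i * w ∈ region R (Set.range s) c χ J := by
      refine (hs.gen_mul_mem_region_iff hJ hc hw i).2 ?_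
      rw [ev_act]
      refine ⟨h0, ?_, ?_⟩
      · rwa [← hc w, hww] at h1
      · rwa [← hc (hs.gen i * w), coe_gen_mul_apply, map_neg, hww, map_neg, refl_self, neg_neg]
          at h2
    refine ih _ ?_ hmem (step w hw base i hmem) rfl
    rw [mul_assoc]
    omega

end IsSimpleSystem

/-! ### The calibrated module -/

variable (R Δ : Set E) (c : E → ℂ) (χ : Character E) (J : Set E)

/-- The action of `p ∈ V` on `ℍ^{(χ, J)}`. -/
noncomputable def weightOp (p : Cplx E) : Module.End ℂ (CalSpace R Δ c χ J) :=
  Finsupp.linearCombination ℂ fun w : region R Δ c χ J =>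
    act (w : E ≃ₗᵢ[ℝ] E) χ p • basisVec R Δ c χ J w

/-- The action of `t_{s_α}` on `ℍ^{(χ, J)}`. -/
noncomputable def reflOp (α : R) : Module.End ℂ (CalSpace R Δ c χ J) :=
  Finsupp.linearCombination ℂ fun w : region R Δ c χ J =>
    (c α / ev (act (w : E ≃ₗᵢ[ℝ] E) χ) α) • basisVec R Δ c χ J w +
      (1 + c α / ev (act (w : E ≃ₗᵢ[ℝ] E) χ) α) • basisVec R Δ c χ J (weylRefl R α * w)

variable {R Δ c χ J}

theorem basisVec_of_mem {w : weylGroup R} (hw : w ∈ region R Δ c χ J) :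
    basisVec R Δ c χ J w = Finsupp.single ⟨w, hw⟩ 1 := dif_pos hw

theorem basisVec_of_notMem {w : weylGroup R} (hw : w ∉ region R Δ c χ J) :
    basisVec R Δ c χ J w = 0 := dif_neg hw

theorem weightOp_basisVec (p : Cplx E) {w : weylGroup R} (hw : w ∈ region R Δ c χ J) :
    weightOp R Δ c χ J p (basisVec R Δ c χ J w) =
      act (w : E ≃ₗᵢ[ℝ] E) χ p • basisVec R Δ c χ J w := by
  conv_lhs => rw [basisVec_of_mem hw, weightOp, Finsupp.linearCombination_single, one_smul]

theorem reflOp_basisVec (α : R) {w : weylGroup R} (hw : w ∈ region R Δ c χ J) :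
    reflOp R Δ c χ J α (basisVec R Δ c χ J w) =
      (c α / ev (act (w : E ≃ₗᵢ[ℝ] E) χ) α) • basisVec R Δ c χ J w +
        (1 + c α / ev (act (w : E ≃ₗᵢ[ℝ] E) χ) α) • basisVec R Δ c χ J (weylRefl R α * w) := by
  conv_lhs => rw [basisVec_of_mem hw, reflOp, Finsupp.linearCombination_single, one_smul]

theorem CalSpace.hom_ext {M : Type*} [AddCommGroup M] [Module ℂ M]
    {f g : CalSpace R Δ c χ J →ₗ[ℂ] M}
    (h : ∀ w ∈ region R Δ c χ J, f (basisVec R Δ c χ J w) = g (basisVec R Δ c χ J w)) : f = g := by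
  refine Finsupp.lhom_ext' fun ⟨w, hw⟩ => LinearMap.ext_ring ?_
  simpa [basisVec_of_mem hw] using h w hw

theorem weightOp_apply (p : Cplx E) (m : CalSpace R Δ c χ J) (w : region R Δ c χ J) :
    weightOp R Δ c χ J p m w = act (w : E ≃ₗᵢ[ℝ] E) χ p * m w := by
  have : Finsupp.lapply w ∘ₗ weightOp R Δ c χ J p =
      act (w : E ≃ₗᵢ[ℝ] E) χ p • (Finsupp.lapply w : CalSpace R Δ c χ J →ₗ[ℂ] ℂ) := by
    refine CalSpace.hom_ext fun u hu => ?_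
    rw [LinearMap.comp_apply, weightOp_basisVec p hu, basisVec_of_mem hu]
    by_cases h : (⟨u, hu⟩ : region R Δ c χ J) = w
    · subst h
      simp
    · simp [h]
  exact LinearMap.congr_fun this m

namespace IsSimpleSystem

variable {s : ι → E} (hs : IsSimpleSystem R s)

/-- Put `q = c / (wχ)(α_i)`. At `s_i w` this quotient is `-q`, so the coefficient of `v_w` in the
square is `q² + (1 + q)(1 - q) = 1` and the other one cancels. When `s_i w` leaves the region, `q =
±1` and `v_w` is an eigenvector. -/
theorem reflOp_mul_self (hJ : J ⊆ paramSet R c χ)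
    (hc : ∀ (w : weylGroup R) γ, c ((w : E ≃ₗᵢ[ℝ] E) γ) = c γ)
    (hreg : ∀ i, ∀ w ∈ region R (Set.range s) c χ J, ev (act (w : E ≃ₗᵢ[ℝ] E) χ) (s i) ≠ 0)
    (i : ι) : reflOp R (Set.range s) c χ J ⟨s i, hs.mem i⟩ *
      reflOp R (Set.range s) c χ J ⟨s i, hs.mem i⟩ = 1 := by
  refine CalSpace.hom_ext fun w hw => ?_
  have h0 := hreg i w hw
  rw [Module.End.mul_apply, reflOp_basisVec _ hw, map_add, map_smul, map_smul,
    reflOp_basisVec _ hw]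
  change _ + _ • reflOp _ _ _ _ _ _ (basisVec _ _ _ _ _ (hs.gen i * w)) = _
  by_cases hm : hs.gen i * w ∈ region R (Set.range s) c χ J
  · rw [reflOp_basisVec _ hm]
    change _ • (_ • _ + _ • basisVec _ _ _ _ _ (hs.gen i * w)) +
      _ • (_ + _ • basisVec _ _ _ _ _ (hs.gen i * (hs.gen i * w))) = _
    have hneg : ev (act ((hs.gen i * w : weylGroup R) : E ≃ₗᵢ[ℝ] E) χ) (s i) =
        -ev (act (w : E ≃ₗᵢ[ℝ] E) χ) (s i) := by
      simp only [ev_act, coe_gen_mul_inv_apply, refl_self, map_neg, ev_neg]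
    simp only [hneg, gen_mul_gen_mul, Module.End.one_apply]
    module
  · rw [basisVec_of_notMem hm]
    change _ • (_ • _ + _ • basisVec _ _ _ _ _ (hs.gen i * w)) + _ = _
    rw [basisVec_of_notMem hm]
    simp only [map_zero, smul_zero, add_zero, smul_smul, Module.End.one_apply]
    rw [hs.gen_mul_mem_region_iff hJ hc hw] at hm
    have : c (s i) / ev (act (w : E ≃ₗᵢ[ℝ] E) χ) (s i) = 1 ∨
        c (s i) / ev (act (w : E ≃ₗᵢ[ℝ] E) χ) (s i) = -1 := by
      by_cases h1 : ev (act (w : E ≃ₗᵢ[ℝ] E) χ) (s i) = c (s i)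
      · rw [← h1]
        exact Or.inl (div_self h0)
      · have h2 : ev (act (w : E ≃ₗᵢ[ℝ] E) χ) (s i) = -c (s i) := by
          by_contra h2
          exact hm ⟨h0, h1, h2⟩
        right
        rw [div_eq_iff h0, h2]
        ring
    rcases this with h | h <;> rw [h] <;> simp

/-- The terms in `v_{s_i w}` cancel because its weight at `s_i p` is `(wχ)(p)`. The rest is `c /
(wχ)(α_i)` times `(wχ)(p - s_i p) = α_i^∨(p) (wχ)(α_i)`. -/
theorem reflOp_cross (hreg : ∀ i, ∀ w ∈ region R (Set.range s) c χ J,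
      ev (act (w : E ≃ₗᵢ[ℝ] E) χ) (s i) ≠ 0) (i : ι) (p : Cplx E) :
    reflOp R (Set.range s) c χ J ⟨s i, hs.mem i⟩ * weightOp R (Set.range s) c χ J p -
      weightOp R (Set.range s) c χ J (cplxMap (refl (s i)) p) *
        reflOp R (Set.range s) c χ J ⟨s i, hs.mem i⟩ =
      algebraMap ℂ _ (c (s i) * cplxCoroot (s i) p) := by
  refine CalSpace.hom_ext fun w hw => ?_
  have h0 := hreg i w hw
  have hw1 : act (w : E ≃ₗᵢ[ℝ] E) χ (cplxMap (refl (s i)) p) = act (w : E ≃ₗᵢ[ℝ] E) χ p -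
      cplxCoroot (s i) p * ev (act (w : E ≃ₗᵢ[ℝ] E) χ) (s i) := by
    rw [cplxMap_refl, map_sub, map_smul]
    rfl
  -- Outside the region both sides vanish, so no case distinction is needed afterwards.
  have hw2 : weightOp R (Set.range s) c χ J (cplxMap (refl (s i)) p)
      (basisVec R (Set.range s) c χ J (hs.gen i * w)) =
      act (w : E ≃ₗᵢ[ℝ] E) χ p • basisVec R (Set.range s) c χ J (hs.gen i * w) := by
    by_cases hm : hs.gen i * w ∈ region R (Set.range s) c χ J
    · rw [weightOp_basisVec _ hm, coe_gen_mul, act_mul]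
      congr 1
      rw [act, LinearMap.comp_apply, refl_inv, cplxMap_refl_refl]
    · rw [basisVec_of_notMem hm, map_zero, smul_zero]
  rw [LinearMap.sub_apply, Module.End.mul_apply, Module.End.mul_apply, weightOp_basisVec _ hw,
    map_smul, reflOp_basisVec _ hw, map_add, map_smul, map_smul, weightOp_basisVec _ hw,
    Module.algebraMap_end_apply]
  change _ - (_ + _ • weightOp _ _ _ _ _ _ (basisVec _ _ _ _ _ (hs.gen i * w))) = _
  rw [hw1, hw2]
  change _ • (_ + _ • basisVec _ _ _ _ _ (hs.gen i * w)) - _ = _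
  have hcc : c (s i) = c (s i) / ev (act (w : E ≃ₗᵢ[ℝ] E) χ) (s i) *
    ev (act (w : E ≃ₗᵢ[ℝ] E) χ) (s i) := by field_simp
  conv_rhs => rw [hcc]
  module

/-- `ℍ^{(χ, J)}` is an `ℍ`-module as soon as the operators of the simple reflections satisfy the
braid relations. -/
theorem exists_calibratedAction {m : ι → ι → ℕ} (hm : IsCoxeterMatrix s m)
    (hJ : J ⊆ paramSet R c χ) (hc : ∀ (w : weylGroup R) γ, c ((w : E ≃ₗᵢ[ℝ] E) γ) = c γ)
    (hreg : ∀ i, ∀ w ∈ region R (Set.range s) c χ J, ev (act (w : E ≃ₗᵢ[ℝ] E) χ) (s i) ≠ 0)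
    (hbraid : ∀ i j, i ≠ j →
      ((altWord (m i j) i j).map fun k => reflOp R (Set.range s) c χ J ⟨s k, hs.mem k⟩).prod =
      ((altWord (m i j) j i).map fun k => reflOp R (Set.range s) c χ J ⟨s k, hs.mem k⟩).prod) :
    ∃ ρ : Hecke R (Set.range s) c →ₐ[ℂ] Module.End ℂ (CalSpace R (Set.range s) c χ J),
      IsCalibratedAction R (Set.range s) c χ J ρ := by
  obtain ⟨T, hT⟩ := hs.exists_monoidHom hm
    (fun k => reflOp R (Set.range s) c χ J ⟨s k, hs.mem k⟩) (hs.reflOp_mul_self hJ hc hreg) hbraid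
  let g : Gen R → Module.End ℂ (CalSpace R (Set.range s) c χ J)
    | Gen.t w => T w
    | Gen.f v => weightOp R (Set.range s) c χ J v
  have hgt : ∀ w, FreeAlgebra.lift ℂ g (preT w) = T w := fun w => FreeAlgebra.lift_ι_apply _ _
  have hgf : ∀ v, FreeAlgebra.lift ℂ g (preF R v) = weightOp R (Set.range s) c χ J v :=
    fun v => FreeAlgebra.lift_ι_apply _ _
  have hrel : ∀ ⦃x y⦄, Rel R (Set.range s) c x y →
      FreeAlgebra.lift ℂ g x = FreeAlgebra.lift ℂ g y := by
    intro x y h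
    cases h with
    | t_one => simp [hgt]
    | t_mul w w' => simp [hgt]
    | f_add v v' =>
      rw [map_add, hgf, hgf, hgf]
      refine CalSpace.hom_ext fun w hw => ?_
      simp [weightOp_basisVec _ hw, add_smul]
    | f_smul z v =>
      rw [map_smul, hgf, hgf]
      refine CalSpace.hom_ext fun w hw => ?_
      simp [weightOp_basisVec _ hw, mul_smul]
    | f_comm v v' =>
      rw [map_mul, map_mul, hgf, hgf]
      refine CalSpace.hom_ext fun w hw => ?_
      simp [weightOp_basisVec _ hw, smul_smul, mul_comm]
    | cross α hα v =>
      obtain ⟨α, hαR⟩ := α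
      obtain ⟨i, rfl⟩ := hα
      rw [map_sub, map_mul, map_mul, hgt, hgf, hgf, AlgHom.commutes, ← hs.reflOp_cross hreg i v,
        ← hT i]
      rfl
  refine ⟨RingQuot.liftAlgHom ℂ ⟨FreeAlgebra.lift ℂ g, hrel⟩, fun w hw => ⟨fun p => ?_, ?_⟩⟩
  · rw [Hecke.f, RingQuot.liftAlgHom_mkAlgHom_apply, hgf, weightOp_basisVec _ hw]
  · rintro ⟨_, hαR⟩ ⟨i, rfl⟩
    rw [Hecke.t, RingQuot.liftAlgHom_mkAlgHom_apply, hgt, ← reflOp_basisVec _ hw]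
    exact LinearMap.congr_fun (hT i) _

end IsSimpleSystem

theorem IsCalibratedAction.apply_f
    {ρ : Hecke R Δ c →ₐ[ℂ] Module.End ℂ (CalSpace R Δ c χ J)}
    (hρ : IsCalibratedAction R Δ c χ J ρ) (p : Cplx E) :
    ρ (Hecke.f R Δ c p) = weightOp R Δ c χ J p :=
  CalSpace.hom_ext fun w hw => by rw [weightOp_basisVec _ hw, (hρ w hw).1 p]

/-- The weights of `ℍ^{(χ, J)}` are the `w χ` with `w ∈ ℱ^{(χ, J)}`. -/
theorem IsCalibratedAction.exists_of_isWeight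
    {ρ : Hecke R Δ c →ₐ[ℂ] Module.End ℂ (CalSpace R Δ c χ J)}
    (hρ : IsCalibratedAction R Δ c χ J ρ) {ψ : Character E} (hψ : IsWeight ρ ψ) :
    ∃ w ∈ region R Δ c χ J, ψ = act (w : E ≃ₗᵢ[ℝ] E) χ := by
  obtain ⟨m, hm, hk⟩ := hψ
  obtain ⟨w, hw⟩ := Finsupp.ne_iff.1 hm
  refine ⟨w, w.2, LinearMap.ext fun v => ?_⟩
  obtain ⟨k, hk⟩ := hk v
  rw [hρ.apply_f] at hk
  -- The operator is diagonal, so a power of it can kill a nonzero coordinate of `m` only if the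
  -- scalar at that coordinate is zero.
  have hpow : ∀ k : ℕ, (((weightOp R Δ c χ J v -
      algebraMap ℂ (Module.End ℂ (CalSpace R Δ c χ J)) (ψ v)) ^ k) m) w =
      (act (w : E ≃ₗᵢ[ℝ] E) χ v - ψ v) ^ k * m w := by
    intro k
    induction k with
    | zero => simp
    | succ k ih =>
      rw [pow_succ', Module.End.mul_apply, LinearMap.sub_apply, Finsupp.sub_apply, weightOp_apply,
        Module.algebraMap_end_apply, Finsupp.smul_apply, ih, smul_eq_mul]
      ring
  have := hpow k
  rw [hk, Finsupp.zero_apply] at this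
  rcases mul_eq_zero.1 this.symm with h | h
  · exact (sub_eq_zero.1 (eq_zero_of_pow_eq_zero h)).symm
  · exact absurd h hw

/-- A non-zero submodule of `ℍ^{(χ, J)}` contains some `v_w`, if the weights `w χ` are distinct. -/
theorem exists_basisVec_mem
    (hinj : ∀ w ∈ region R Δ c χ J, ∀ w' ∈ region R Δ c χ J,
      act (w : E ≃ₗᵢ[ℝ] E) χ = act (w' : E ≃ₗᵢ[ℝ] E) χ → w = w')
    {N : Submodule ℂ (CalSpace R Δ c χ J)} (hN : ∀ p, ∀ m ∈ N, weightOp R Δ c χ J p m ∈ N)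
    (hne : N ≠ ⊥) : ∃ w ∈ region R Δ c χ J, basisVec R Δ c χ J w ∈ N := by
  obtain ⟨m, hmN, hm⟩ := N.ne_bot_iff.1 hne
  induction hn : m.support.card using Nat.strong_induction_on generalizing m with
  | _ n ih =>
    obtain ⟨w, hw⟩ := Finsupp.ne_iff.1 hm
    by_cases hall : ∀ w', m w' ≠ 0 → w' = w
    · refine ⟨w, w.2, ?_⟩
      have : basisVec R Δ c χ J w = (m w)⁻¹ • m := by
        rw [basisVec_of_mem w.2]
        classical
        ext w'
        by_cases h : w' = w
        · subst h
          simpa using (inv_mul_cancel₀ hw).symm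
        · rw [Finsupp.single_apply, if_neg (Ne.symm h), Finsupp.smul_apply,
            not_not.1 (mt (hall w') h), smul_zero]
      rw [this]
      exact N.smul_mem _ hmN
    · push Not at hall
      obtain ⟨w', hw', hww⟩ := hall
      have : act (w : E ≃ₗᵢ[ℝ] E) χ ≠ act (w' : E ≃ₗᵢ[ℝ] E) χ := fun h =>
        hww (Subtype.ext (hinj w w.2 w' w'.2 h)).symm
      obtain ⟨p, hp⟩ : ∃ p, act (w : E ≃ₗᵢ[ℝ] E) χ p ≠ act (w' : E ≃ₗᵢ[ℝ] E) χ p := by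
        by_contra! h
        exact this (LinearMap.ext h)
      -- This combination kills the coordinate at `w'`, keeps the one at `w`, and creates no new
      -- ones: the support shrinks.
      set m' := weightOp R Δ c χ J p m - act (w' : E ≃ₗᵢ[ℝ] E) χ p • m with hm'
      have hval : ∀ u, m' u = (act (u : E ≃ₗᵢ[ℝ] E) χ p - act (w' : E ≃ₗᵢ[ℝ] E) χ p) * m u := by
        intro u
        rw [hm', Finsupp.sub_apply, weightOp_apply, Finsupp.smul_apply, smul_eq_mul, sub_mul]
      refine ih _ ?_ m' (N.sub_mem (hN p m hmN) (N.smul_mem _ hmN)) ?_ rfl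
      · rw [← hn]
        refine Finset.card_lt_card ⟨fun u hu => ?_, fun h => ?_⟩
        · rw [Finsupp.mem_support_iff, hval] at hu
          exact Finsupp.mem_support_iff.2 (right_ne_zero_of_mul hu)
        · have := h (Finsupp.mem_support_iff.2 hw')
          rw [Finsupp.mem_support_iff, hval, sub_self, zero_mul] at this
          exact this rfl
      · intro h
        have := hval w
        rw [h, Finsupp.zero_apply] at this
        exact mul_ne_zero (sub_ne_zero.2 hp) hw this.symm

/-- `ℍ^{(χ, J)}` is irreducible, if the weights `w χ` are distinct. -/
theorem IsSimpleSystem.isIrreducible {s : ι → E} (hs : IsSimpleSystem R s)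
    (hJ : J ⊆ paramSet R c χ) (hc : ∀ (w : weylGroup R) γ, c ((w : E ≃ₗᵢ[ℝ] E) γ) = c γ)
    (hne : (region R (Set.range s) c χ J).Nonempty)
    (hinj : ∀ w ∈ region R (Set.range s) c χ J, ∀ w' ∈ region R (Set.range s) c χ J,
      act (w : E ≃ₗᵢ[ℝ] E) χ = act (w' : E ≃ₗᵢ[ℝ] E) χ → w = w')
    {ρ : Hecke R (Set.range s) c →ₐ[ℂ] Module.End ℂ (CalSpace R (Set.range s) c χ J)}
    (hρ : IsCalibratedAction R (Set.range s) c χ J ρ) : IsIrreducible ρ := by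
  refine ⟨?_, fun N hN => or_iff_not_imp_left.2 fun hbot => ?_⟩
  · obtain ⟨w, hw⟩ := hne
    exact ⟨⟨Finsupp.single ⟨w, hw⟩ 1, 0, by simp⟩⟩
  obtain ⟨w, hw, hwN⟩ := exists_basisVec_mem hinj
    (fun p m hm => hρ.apply_f p ▸ hN _ m hm) hbot
  have hall : ∀ u ∈ region R (Set.range s) c χ J, basisVec R (Set.range s) c χ J u ∈ N := by
    intro u hu
    refine hs.region_induction hJ hc (p := fun u => basisVec R (Set.range s) c χ J u ∈ N) hw hu hwN
      fun x hx hxN i hix => ?_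
    have h1 := hN (Hecke.t (Set.range s) c (hs.gen i)) _ hxN
    have h2 : ρ (Hecke.t (Set.range s) c (hs.gen i)) (basisVec R (Set.range s) c χ J x) = _ :=
      (hρ x hx).2 ⟨s i, hs.mem i⟩ ⟨i, rfl⟩
    rw [h2] at h1
    -- Only the multiple of `v_{s_i x}` is left, and its coefficient `1 + c / (xχ)(α_i)` is nonzero
    -- because the value at an edge is not `-c`.
    have h3 := (N.add_mem_iff_right (N.smul_mem _ hxN)).1 h1
    refine (N.smul_mem_iff ?_).1 h3
    obtain ⟨h0, -, h0'⟩ := (hs.gen_mul_mem_region_iff hJ hc hx i).1 hix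
    intro h
    apply h0'
    rw [eq_neg_iff_add_eq_zero]
    rwa [one_add_div h0, div_eq_zero_iff, or_iff_left h0] at h
  refine (Submodule.eq_top_iff'.2 fun m => ?_)
  induction m using Finsupp.induction_linear with
  | zero => exact N.zero_mem
  | add f g hf hg => exact N.add_mem hf hg
  | single u z =>
    have := N.smul_mem z (hall u u.2)
    rwa [basisVec_of_mem u.2, Finsupp.smul_single, smul_eq_mul, mul_one] at this

end Calibrated
/-! ### The ring `ℤ[φ]`, where `φ` is the golden ratio -/

/-- The element `a + b φ` of `ℤ[φ]`. -/
@[ext]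
structure Zphi where
  a : ℤ
  b : ℤ
  deriving DecidableEq

namespace Zphi

instance : Zero Zphi := ⟨⟨0, 0⟩⟩
instance : One Zphi := ⟨⟨1, 0⟩⟩
instance : Add Zphi := ⟨fun x y => ⟨x.a + y.a, x.b + y.b⟩⟩
instance : Neg Zphi := ⟨fun x => ⟨-x.a, -x.b⟩⟩
instance : Mul Zphi := ⟨fun x y => ⟨x.a * y.a + x.b * y.b, x.a * y.b + x.b * y.a + x.b * y.b⟩⟩

/-- The embedding of `ℤ[φ]` into `ℝ`. -/
noncomputable def toReal (x : Zphi) : ℝ := x.a + x.b * Real.goldenRatio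

@[simp] theorem toReal_mk (a b : ℤ) : toReal ⟨a, b⟩ = a + b * Real.goldenRatio := rfl

@[simp] theorem toReal_zero : toReal 0 = 0 := by
  simp [show (0 : Zphi) = ⟨0, 0⟩ from rfl]

@[simp] theorem toReal_one : toReal 1 = 1 := by
  simp [show (1 : Zphi) = ⟨1, 0⟩ from rfl]

@[simp] theorem toReal_add (x y : Zphi) : toReal (x + y) = toReal x + toReal y := by
  rw [show x + y = ⟨x.a + y.a, x.b + y.b⟩ from rfl]
  simp only [toReal, Int.cast_add]
  ring

@[simp] theorem toReal_neg (x : Zphi) : toReal (-x) = -toReal x := by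
  rw [show -x = ⟨-x.a, -x.b⟩ from rfl]
  simp only [toReal, Int.cast_neg]
  ring

@[simp] theorem toReal_mul (x y : Zphi) : toReal (x * y) = toReal x * toReal y := by
  rw [show x * y = ⟨x.a * y.a + x.b * y.b, x.a * y.b + x.b * y.a + x.b * y.b⟩ from rfl]
  simp only [toReal, Int.cast_add, Int.cast_mul]
  linear_combination (-x.b * y.b : ℝ) * Real.goldenRatio_sq

/-- Irrationality of the golden ratio turns equalities of real numbers into decidable equalities of
integer pairs. -/
theorem toReal_injective : Function.Injective toReal := by
  intro x y h
  have hb : x.b = y.b := by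
    by_contra hne
    have h1 : ((y.b - x.b : ℤ) : ℝ) * Real.goldenRatio = ((x.a - y.a : ℤ) : ℝ) := by
      simp only [toReal] at h
      push_cast
      linarith
    exact ((Real.goldenRatio_irrational.intCast_mul (sub_ne_zero.2 (Ne.symm hne))).ne_int _) h1
  have ha : x.a = y.a := by
    simp only [toReal, hb, add_left_inj, Int.cast_inj] at h
    exact h
  exact Zphi.ext ha hb

theorem toReal_eq_zero {x : Zphi} : toReal x = 0 ↔ x = 0 := by
  rw [← toReal_zero, toReal_injective.eq_iff]

/-- A sufficient condition for `0 ≤ x`. -/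
def nonneg (x : Zphi) : Bool := decide (0 ≤ x.a) && decide (0 ≤ x.b)

theorem toReal_nonneg {x : Zphi} (h : x.nonneg = true) : 0 ≤ toReal x := by
  rw [nonneg, Bool.and_eq_true, decide_eq_true_iff, decide_eq_true_iff] at h
  have := Real.goldenRatio_pos
  have h1 : (0 : ℝ) ≤ x.a := by exact_mod_cast h.1
  have h2 : (0 : ℝ) ≤ x.b := by exact_mod_cast h.2
  rw [toReal]
  positivity

/-- The criterion for `2 (a + b φ) = (2 a + b) + b √5` to be negative. -/
def isNeg (x : Zphi) : Bool :=
  let p := 2 * x.a + x.b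
  (decide (p < 0) && (decide (x.b ≤ 0) || decide (5 * x.b * x.b < p * p))) ||
    (decide (x.b < 0) && decide (p * p < 5 * x.b * x.b))

/-- When `2a + b` and `b` have opposite signs, the sign of `(2a + b) + b√5` is found by comparing
squares. -/
theorem toReal_neg_of_isNeg {x : Zphi} (h : x.isNeg = true) : toReal x < 0 := by
  simp only [isNeg, Bool.or_eq_true, Bool.and_eq_true, decide_eq_true_iff] at h
  have h5 : (√5 : ℝ) ^ 2 = 5 := Real.sq_sqrt (by norm_num)
  have h5' : 0 < √5 := by positivity
  have key : 2 * toReal x = ((2 * x.a + x.b : ℤ) : ℝ) + (x.b : ℝ) * √5 := by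
    rw [toReal, Real.goldenRatio]
    push_cast
    ring
  set p := 2 * x.a + x.b
  rcases h with ⟨hp, hb | hb⟩ | ⟨hb, hp⟩
  · have hp' : (p : ℝ) < 0 := by exact_mod_cast hp
    have hb' : (x.b : ℝ) ≤ 0 := by exact_mod_cast hb
    nlinarith
  · have hp' : (p : ℝ) < 0 := by exact_mod_cast hp
    have hb' : 5 * (x.b : ℝ) * x.b < p * p := by exact_mod_cast hb
    have : (x.b : ℝ) * √5 < -p := lt_of_pow_lt_pow_left₀ 2 (by linarith) (by nlinarith)
    linarith
  · have hb' : (x.b : ℝ) < 0 := by exact_mod_cast hb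
    have hp' : (p : ℝ) * p < 5 * x.b * x.b := by exact_mod_cast hp
    have : (p : ℝ) < -x.b * √5 :=
      lt_of_pow_lt_pow_left₀ 2 (mul_nonneg (by linarith) h5'.le) (by nlinarith)
    linarith

end Zphi

/-! ### Vectors with coordinates in `ℤ[φ]` -/

/-- A vector with four coordinates in `ℤ[φ]`. -/
@[ext]
structure Coord where
  x₀ : Zphi
  x₁ : Zphi
  x₂ : Zphi
  x₃ : Zphi
  deriving DecidableEq

namespace Coord

/-- The coordinates of a vector. -/
def get (x : Coord) : Fin 4 → Zphi
  | 0 => x.x₀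
  | 1 => x.x₁
  | 2 => x.x₂
  | 3 => x.x₃

instance : Add Coord := ⟨fun x y => ⟨x.x₀ + y.x₀, x.x₁ + y.x₁, x.x₂ + y.x₂, x.x₃ + y.x₃⟩⟩
instance : Neg Coord := ⟨fun x => ⟨-x.x₀, -x.x₁, -x.x₂, -x.x₃⟩⟩
instance : SMul Zphi Coord := ⟨fun z x => ⟨z * x.x₀, z * x.x₁, z * x.x₂, z * x.x₃⟩⟩

/-- The standard basis. -/
def single : Fin 4 → Coord
  | 0 => ⟨1, 0, 0, 0⟩
  | 1 => ⟨0, 1, 0, 0⟩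
  | 2 => ⟨0, 0, 1, 0⟩
  | 3 => ⟨0, 0, 0, 1⟩

/-- The standard bilinear form. -/
def dot (x y : Coord) : Zphi := x.x₀ * y.x₀ + x.x₁ * y.x₁ + x.x₂ * y.x₂ + x.x₃ * y.x₃

theorem toReal_dot (x y : Coord) :
    (dot x y).toReal = ∑ i, (x.get i).toReal * (y.get i).toReal := by
  simp [dot, Fin.sum_univ_four, get]

theorem get_add (x y : Coord) (i : Fin 4) : (x + y).get i = x.get i + y.get i := by
  fin_cases i <;> rfl

theorem get_neg (x : Coord) (i : Fin 4) : (-x).get i = -x.get i := by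
  fin_cases i <;> rfl

theorem get_smul (z : Zphi) (x : Coord) (i : Fin 4) : (z • x).get i = z * x.get i := by
  fin_cases i <;> rfl

theorem ext_get {x y : Coord} (h : ∀ i, x.get i = y.get i) : x = y :=
  Coord.ext (h 0) (h 1) (h 2) (h 3)

/-- The rows of the Cartan matrix of type `H₄`. -/
def cartan : Fin 4 → Coord
  | 0 => ⟨⟨2, 0⟩, ⟨-1, 0⟩, ⟨0, 0⟩, ⟨0, 0⟩⟩
  | 1 => ⟨⟨-1, 0⟩, ⟨2, 0⟩, ⟨-1, 0⟩, ⟨0, 0⟩⟩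
  | 2 => ⟨⟨0, 0⟩, ⟨-1, 0⟩, ⟨2, 0⟩, ⟨0, -1⟩⟩
  | 3 => ⟨⟨0, 0⟩, ⟨0, 0⟩, ⟨0, -1⟩, ⟨2, 0⟩⟩

/-- The coordinates of the fundamental weights with respect to the simple roots. -/
def weight : Fin 4 → Coord
  | 0 => ⟨⟨2, 2⟩, ⟨3, 4⟩, ⟨4, 6⟩, ⟨3, 5⟩⟩
  | 1 => ⟨⟨3, 4⟩, ⟨6, 8⟩, ⟨8, 12⟩, ⟨6, 10⟩⟩
  | 2 => ⟨⟨4, 6⟩, ⟨8, 12⟩, ⟨12, 18⟩, ⟨9, 15⟩⟩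
  | 3 => ⟨⟨3, 5⟩, ⟨6, 10⟩, ⟨9, 15⟩, ⟨8, 12⟩⟩

/-- The product of the Cartan matrix with a vector. -/
def cartanMul (x : Coord) : Coord :=
  ⟨dot (cartan 0) x, dot (cartan 1) x, dot (cartan 2) x, dot (cartan 3) x⟩

/-- The inner product of two vectors given by their coordinates with respect to the simple
roots. -/
def form (x y : Coord) : Zphi := dot x (cartanMul y)

/-- The reflection in the `i`-th simple root. -/
def reflect (i : Fin 4) (x : Coord) : Coord := x + -(dot (cartan i) x) • single i

/-- The image of `x` under a word in the simple reflections. -/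
def applyWord (l : List (Fin 4)) (x : Coord) : Coord := l.foldr reflect x

/-- Standard coordinates, multiplied by `√2`, of the vector with coordinates `x` with respect to
the simple roots. -/
def toStd (x : Coord) : Coord :=
  ⟨⟨-1, 0⟩ * x.x₀ + x.x₁ + ⟨0, -1⟩ * x.x₂ + ⟨0, 1⟩ * x.x₃,
   ⟨0, -1⟩ * x.x₀ + ⟨-1, 1⟩ * x.x₁ + x.x₂ + -x.x₃,
   ⟨0, -1⟩ * x.x₁ + ⟨-1, 1⟩ * x.x₂ + ⟨-1, 1⟩ * x.x₃,
   ⟨-1, 1⟩ * x.x₀⟩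

end Coord

open Coord

/-- The coordinates of the positive roots with respect to the simple roots. -/
def posList : List Coord :=
  [⟨⟨0, 0⟩, ⟨0, 0⟩, ⟨0, 0⟩, ⟨1, 0⟩⟩, ⟨⟨0, 0⟩, ⟨0, 0⟩, ⟨1, 0⟩, ⟨0, 0⟩⟩,
  ⟨⟨0, 0⟩, ⟨1, 0⟩, ⟨0, 0⟩, ⟨0, 0⟩⟩, ⟨⟨1, 0⟩, ⟨0, 0⟩, ⟨0, 0⟩, ⟨0, 0⟩⟩,
  ⟨⟨0, 0⟩, ⟨1, 0⟩, ⟨1, 0⟩, ⟨0, 0⟩⟩, ⟨⟨1, 0⟩, ⟨1, 0⟩, ⟨0, 0⟩, ⟨0, 0⟩⟩,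
  ⟨⟨0, 0⟩, ⟨0, 0⟩, ⟨1, 0⟩, ⟨0, 1⟩⟩, ⟨⟨0, 0⟩, ⟨0, 0⟩, ⟨0, 1⟩, ⟨1, 0⟩⟩,
  ⟨⟨1, 0⟩, ⟨1, 0⟩, ⟨1, 0⟩, ⟨0, 0⟩⟩, ⟨⟨0, 0⟩, ⟨0, 0⟩, ⟨0, 1⟩, ⟨0, 1⟩⟩,
  ⟨⟨0, 0⟩, ⟨1, 0⟩, ⟨1, 0⟩, ⟨0, 1⟩⟩, ⟨⟨0, 0⟩, ⟨0, 1⟩, ⟨0, 1⟩, ⟨1, 0⟩⟩,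
  ⟨⟨1, 0⟩, ⟨1, 0⟩, ⟨1, 0⟩, ⟨0, 1⟩⟩, ⟨⟨0, 0⟩, ⟨0, 1⟩, ⟨0, 1⟩, ⟨0, 1⟩⟩,
  ⟨⟨0, 0⟩, ⟨1, 0⟩, ⟨1, 1⟩, ⟨0, 1⟩⟩, ⟨⟨0, 0⟩, ⟨0, 1⟩, ⟨1, 1⟩, ⟨0, 1⟩⟩,
  ⟨⟨0, 1⟩, ⟨0, 1⟩, ⟨0, 1⟩, ⟨1, 0⟩⟩, ⟨⟨0, 0⟩, ⟨1, 0⟩, ⟨1, 1⟩, ⟨1, 1⟩⟩,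
  ⟨⟨1, 0⟩, ⟨1, 0⟩, ⟨1, 1⟩, ⟨0, 1⟩⟩, ⟨⟨0, 1⟩, ⟨0, 1⟩, ⟨0, 1⟩, ⟨0, 1⟩⟩,
  ⟨⟨0, 0⟩, ⟨0, 1⟩, ⟨1, 1⟩, ⟨1, 1⟩⟩, ⟨⟨1, 0⟩, ⟨1, 0⟩, ⟨1, 1⟩, ⟨1, 1⟩⟩,
  ⟨⟨0, 0⟩, ⟨0, 1⟩, ⟨0, 2⟩, ⟨1, 1⟩⟩, ⟨⟨0, 1⟩, ⟨0, 1⟩, ⟨1, 1⟩, ⟨0, 1⟩⟩,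
  ⟨⟨1, 0⟩, ⟨1, 1⟩, ⟨1, 1⟩, ⟨0, 1⟩⟩, ⟨⟨0, 1⟩, ⟨0, 1⟩, ⟨1, 1⟩, ⟨1, 1⟩⟩,
  ⟨⟨0, 1⟩, ⟨1, 1⟩, ⟨1, 1⟩, ⟨0, 1⟩⟩, ⟨⟨1, 0⟩, ⟨1, 1⟩, ⟨1, 1⟩, ⟨1, 1⟩⟩,
  ⟨⟨0, 1⟩, ⟨0, 1⟩, ⟨0, 2⟩, ⟨1, 1⟩⟩, ⟨⟨0, 1⟩, ⟨1, 1⟩, ⟨1, 1⟩, ⟨1, 1⟩⟩,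
  ⟨⟨1, 0⟩, ⟨1, 1⟩, ⟨1, 2⟩, ⟨1, 1⟩⟩, ⟨⟨0, 1⟩, ⟨0, 2⟩, ⟨0, 2⟩, ⟨1, 1⟩⟩,
  ⟨⟨0, 1⟩, ⟨1, 1⟩, ⟨1, 2⟩, ⟨1, 1⟩⟩, ⟨⟨0, 1⟩, ⟨0, 2⟩, ⟨1, 2⟩, ⟨1, 1⟩⟩,
  ⟨⟨1, 0⟩, ⟨1, 1⟩, ⟨1, 2⟩, ⟨1, 2⟩⟩, ⟨⟨0, 1⟩, ⟨1, 1⟩, ⟨1, 2⟩, ⟨1, 2⟩⟩,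
  ⟨⟨1, 0⟩, ⟨1, 1⟩, ⟨2, 2⟩, ⟨1, 2⟩⟩, ⟨⟨0, 1⟩, ⟨0, 2⟩, ⟨1, 2⟩, ⟨1, 2⟩⟩,
  ⟨⟨0, 1⟩, ⟨1, 1⟩, ⟨2, 2⟩, ⟨1, 2⟩⟩, ⟨⟨1, 0⟩, ⟨2, 1⟩, ⟨2, 2⟩, ⟨1, 2⟩⟩,
  ⟨⟨0, 1⟩, ⟨0, 2⟩, ⟨1, 3⟩, ⟨1, 2⟩⟩, ⟨⟨0, 1⟩, ⟨1, 2⟩, ⟨2, 2⟩, ⟨1, 2⟩⟩,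
  ⟨⟨1, 1⟩, ⟨2, 1⟩, ⟨2, 2⟩, ⟨1, 2⟩⟩, ⟨⟨0, 1⟩, ⟨0, 2⟩, ⟨1, 3⟩, ⟨2, 2⟩⟩,
  ⟨⟨0, 1⟩, ⟨1, 2⟩, ⟨1, 3⟩, ⟨1, 2⟩⟩, ⟨⟨1, 1⟩, ⟨1, 2⟩, ⟨2, 2⟩, ⟨1, 2⟩⟩,
  ⟨⟨0, 1⟩, ⟨1, 2⟩, ⟨1, 3⟩, ⟨2, 2⟩⟩, ⟨⟨1, 1⟩, ⟨1, 2⟩, ⟨1, 3⟩, ⟨1, 2⟩⟩,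
  ⟨⟨0, 1⟩, ⟨1, 2⟩, ⟨2, 3⟩, ⟨2, 2⟩⟩, ⟨⟨1, 1⟩, ⟨1, 2⟩, ⟨1, 3⟩, ⟨2, 2⟩⟩,
  ⟨⟨0, 1⟩, ⟨1, 2⟩, ⟨2, 3⟩, ⟨1, 3⟩⟩, ⟨⟨1, 1⟩, ⟨1, 2⟩, ⟨2, 3⟩, ⟨2, 2⟩⟩,
  ⟨⟨1, 1⟩, ⟨1, 2⟩, ⟨2, 3⟩, ⟨1, 3⟩⟩, ⟨⟨1, 1⟩, ⟨2, 2⟩, ⟨2, 3⟩, ⟨2, 2⟩⟩,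
  ⟨⟨1, 1⟩, ⟨2, 2⟩, ⟨2, 3⟩, ⟨1, 3⟩⟩, ⟨⟨1, 1⟩, ⟨2, 2⟩, ⟨3, 3⟩, ⟨1, 3⟩⟩,
  ⟨⟨1, 1⟩, ⟨2, 2⟩, ⟨3, 3⟩, ⟨2, 3⟩⟩, ⟨⟨1, 1⟩, ⟨2, 2⟩, ⟨2, 4⟩, ⟨2, 3⟩⟩,
  ⟨⟨1, 1⟩, ⟨1, 3⟩, ⟨2, 4⟩, ⟨2, 3⟩⟩, ⟨⟨0, 2⟩, ⟨1, 3⟩, ⟨2, 4⟩, ⟨2, 3⟩⟩]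

/-- The roots whose coordinates vanish outside two simple roots. -/
def rankTwoList : List Coord :=
  posList.filter fun x => decide (∃ i j, ∀ l, l ≠ i → l ≠ j → x.get l = 0)

/-! ### Finite verifications on the 60 positive roots -/

theorem nonneg_of_mem_posList : ∀ x ∈ posList, ∀ i, (x.get i).nonneg = true := by
  decide +kernel

/-- This excludes the zero vector, whence no root is both positive and negative. -/
theorem height_of_mem_posList : ∀ x ∈ posList,
    x.x₀ + x.x₁ + x.x₂ + x.x₃ ≠ 0 := by
  decide +kernel

theorem single_mem_posList : ∀ i, single i ∈ posList := by
  decide +kernel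

theorem nodup_posList : posList.Nodup := by
  decide +kernel

theorem reflect_mem_posList : ∀ x ∈ posList, ∀ i, x = single i ∨ reflect i x ∈ posList := by
  decide +kernel

/-- A measure of the height of a positive root. -/
def size (x : Coord) : ℕ :=
  (x.x₀.a + x.x₁.a + x.x₂.a + x.x₃.a + 2 * (x.x₀.b + x.x₁.b + x.x₂.b + x.x₃.b)).toNat

/-- Every positive root descends to a simple one through simple reflections, so stability of the
root system need only be checked for the latter. -/
theorem exists_size_lt : ∀ x ∈ posList,
    (∃ i, x = single i) ∨ ∃ i, reflect i x ∈ posList ∧ size (reflect i x) < size x := by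
  decide +kernel

/-- The sum of the positive roots. -/
def posSum : Coord := posList.foldr (· + ·) ⟨0, 0, 0, 0⟩

theorem form_posSum_single : ∀ i, form posSum (single i) = ⟨2, 0⟩ := by
  decide +kernel

/-- With roots of square length 2, the product of a positive root with the sum `2ρ` of positive
roots is twice its height; the value 2 singles out the simple roots. -/
theorem exists_of_form_posSum : ∀ x ∈ posList, form posSum x = ⟨2, 0⟩ → ∃ i, x = single i := by
  decide +kernel

/-- The Coxeter diagram of type `H₄` has no nontrivial symmetry. -/
theorem eq_self_of_cartan : ∀ f : Fin 4 → Fin 4,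
    (∀ i k, (cartan (f i)).get (f k) = (cartan i).get k) → ∀ i, f i = i := by
  decide +kernel

theorem form_weight_single : ∀ i k, form (weight i) (single k) = if i = k then 1 else 0 := by
  decide +kernel

/-- The values of the even permutations of four elements. -/
def evenTuples : List (Fin 4 × Fin 4 × Fin 4 × Fin 4) :=
  [(0, 1, 2, 3), (0, 2, 3, 1), (0, 3, 1, 2), (1, 0, 3, 2), (1, 2, 0, 3), (1, 3, 2, 0),
    (2, 0, 1, 3), (2, 1, 3, 0), (2, 3, 0, 1), (3, 0, 2, 1), (3, 1, 0, 2), (3, 2, 1, 0)]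

theorem mem_evenTuples : ∀ σ : Equiv.Perm (Fin 4), σ.sign = 1 → (σ 0, σ 1, σ 2, σ 3) ∈ evenTuples := by
  decide +kernel

theorem exists_of_mem_evenTuples : ∀ t ∈ evenTuples, ∃ σ : Equiv.Perm (Fin 4), σ.sign = 1 ∧
    σ 0 = t.1 ∧ σ 1 = t.2.1 ∧ σ 2 = t.2.2.1 ∧ σ 3 = t.2.2.2 := by
  decide +kernel

/-- Standard coordinates, multiplied by `√2`, of the vectors defining the root system. -/
def stdSeeds : List Coord :=
  [⟨⟨2, 0⟩, 0, 0, 0⟩, ⟨1, 1, 1, 1⟩, ⟨⟨0, 1⟩, 1, ⟨-1, 1⟩, 0⟩]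

/-- Multiplication by a sign. -/
def Zphi.withSign (e : Bool) (x : Zphi) : Zphi := bif e then x else -x

/-- The vector obtained from `u` by a permutation of coordinates and sign changes. -/
def signedPerm (u : Coord) (t : Fin 4 × Fin 4 × Fin 4 × Fin 4) (e₀ e₁ e₂ e₃ : Bool) : Coord :=
  ⟨(u.get t.1).withSign e₀, (u.get t.2.1).withSign e₁, (u.get t.2.2.1).withSign e₂,
    (u.get t.2.2.2).withSign e₃⟩

theorem signedPerm_mem : ∀ u ∈ stdSeeds, ∀ t ∈ evenTuples, ∀ e₀ e₁ e₂ e₃,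
    ∃ x ∈ posList, signedPerm u t e₀ e₁ e₂ e₃ = toStd x ∨
      signedPerm u t e₀ e₁ e₂ e₃ = toStd (-x) := by
  decide +kernel

theorem exists_signedPerm : ∀ x ∈ posList, ∃ u ∈ stdSeeds, ∃ t ∈ evenTuples, ∃ e₀ e₁ e₂ e₃,
    signedPerm u t e₀ e₁ e₂ e₃ = toStd x := by
  decide +kernel

/-! ### The root system of type `H₄` in coordinates -/

/-- The vector with coordinates `x` with respect to the simple roots. -/
noncomputable def ofCoord (x : Coord) : E4 := ∑ i, (x.get i).toReal • simpleH4 i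

theorem ca_eq : ca = Real.goldenRatio / 2 := by
  rw [ca, Real.goldenRatio]; ring

theorem cb_eq : cb = (Real.goldenRatio - 1) / 2 := by
  rw [cb, Real.goldenRatio]; ring

theorem ofCoord_apply (x : Coord) (k : Fin 4) :
    ofCoord x k = √2 / 2 * ((toStd x).get k).toReal := by
  fin_cases k <;>
  simp [ofCoord, Fin.sum_univ_four, simpleH4, vec, toStd, Coord.get, ca_eq, cb_eq] <;> ring

@[simp]
theorem ofCoord_add (x y : Coord) : ofCoord (x + y) = ofCoord x + ofCoord y := by
  simp [ofCoord, get_add, add_smul, Finset.sum_add_distrib]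

@[simp]
theorem ofCoord_neg (x : Coord) : ofCoord (-x) = -ofCoord x := by
  simp [ofCoord, get_neg]

@[simp]
theorem ofCoord_smul (z : Zphi) (x : Coord) : ofCoord (z • x) = z.toReal • ofCoord x := by
  simp [ofCoord, get_smul, mul_smul, Finset.smul_sum]

@[simp]
theorem ofCoord_single (i : Fin 4) : ofCoord (single i) = simpleH4 i := by
  fin_cases i <;> simp [ofCoord, Fin.sum_univ_four, single, Coord.get]

/-- A polynomial identity in the coordinates modulo `√2 * √2 = 2` and `φ² = φ + 1`. -/
theorem inner_ofCoord (x y : Coord) : inner ℝ (ofCoord x) (ofCoord y) = (form x y).toReal := by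
  have h2 : √2 * √2 = 2 := Real.mul_self_sqrt (by norm_num)
  have h : inner ℝ (ofCoord x) (ofCoord y) = (dot (toStd x) (toStd y)).toReal / 2 := by
    rw [PiLp.inner_apply, toReal_dot]
    simp only [ofCoord_apply, Fin.sum_univ_four, RCLike.inner_apply, conj_trivial]
    linear_combination (((toStd x).get 0).toReal * ((toStd y).get 0).toReal +
      ((toStd x).get 1).toReal * ((toStd y).get 1).toReal +
      ((toStd x).get 2).toReal * ((toStd y).get 2).toReal +
      ((toStd x).get 3).toReal * ((toStd y).get 3).toReal) / 4 * h2
  rw [h]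
  have hφ := Real.goldenRatio_sq
  simp only [form, cartanMul, dot, toStd, cartan, Zphi.toReal_add, Zphi.toReal_mul, Zphi.toReal_mk,
    Zphi.toReal_neg]
  push_cast
  linear_combination (x.x₀.toReal * y.x₀.toReal + x.x₁.toReal * y.x₁.toReal +
    x.x₂.toReal * y.x₂.toReal + x.x₃.toReal * y.x₃.toReal -
    (x.x₀.toReal * y.x₁.toReal + x.x₁.toReal * y.x₀.toReal +
    x.x₁.toReal * y.x₂.toReal + x.x₂.toReal * y.x₁.toReal +
    x.x₁.toReal * y.x₃.toReal + x.x₃.toReal * y.x₁.toReal) / 2) * hφ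


/-- The coefficient of a vector at the `i`-th simple root. -/
noncomputable def coeff (i : Fin 4) (v : E4) : ℝ := inner ℝ (ofCoord (weight i)) v

@[simp]
theorem coeff_simple (i k : Fin 4) : coeff i (simpleH4 k) = if i = k then 1 else 0 := by
  rw [coeff, ← ofCoord_single, inner_ofCoord, form_weight_single]
  split_ifs <;> simp

@[simp]
theorem coeff_ofCoord (i : Fin 4) (x : Coord) : coeff i (ofCoord x) = (x.get i).toReal := by
  have h : ∀ k, inner ℝ (ofCoord (weight i)) (simpleH4 k) = if i = k then (1 : ℝ) else 0 :=
    coeff_simple i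
  rw [coeff, show ofCoord x = ∑ k, (x.get k).toReal • simpleH4 k from rfl, inner_sum]
  simp [inner_smul_right, h]

theorem ofCoord_injective : Function.Injective ofCoord := fun x y h =>
  Coord.ext_get fun i => Zphi.toReal_injective (by rw [← coeff_ofCoord, h, coeff_ofCoord])

theorem linearIndependent_simpleH4 : LinearIndependent ℝ simpleH4 := by
  rw [Fintype.linearIndependent_iff]
  intro g hg i
  have : coeff i (∑ k, g k • simpleH4 k) = g i := by
    have h : ∀ k, inner ℝ (ofCoord (weight i)) (simpleH4 k) = if i = k then (1 : ℝ) else 0 :=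
      coeff_simple i
    simp [coeff, inner_sum, inner_smul_right, h]
  rw [← this, hg, coeff, inner_zero_right]

/-- The simple roots as a basis. -/
noncomputable def simpleBasis : Module.Basis (Fin 4) ℝ E4 :=
  basisOfLinearIndependentOfCardEqFinrank linearIndependent_simpleH4 (by simp)

@[simp]
theorem simpleBasis_apply (i : Fin 4) : simpleBasis i = simpleH4 i := by
  simp [simpleBasis]

theorem isometry_ext {u u' : E4 ≃ₗᵢ[ℝ] E4} (h : ∀ i, u (simpleH4 i) = u' (simpleH4 i)) :
    u = u' := by
  have : (u.toLinearEquiv : E4 →ₗ[ℝ] E4) = u'.toLinearEquiv :=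
    simpleBasis.ext fun i => by simpa using h i
  ext1 v
  exact LinearMap.congr_fun this v

theorem character_ext {χ χ' : Character E4} (h : ∀ i, ev χ (simpleH4 i) = ev χ' (simpleH4 i)) :
    χ = χ' := by
  refine Character.ext_of_ev fun v => ?_
  rw [← simpleBasis.sum_repr v]
  simp [ev_sum, ev_smul, h]

theorem coroot_simple_ofCoord (i : Fin 4) (x : Coord) :
    coroot (simpleH4 i) (ofCoord x) = (dot (cartan i) x).toReal := by
  have hf : ∀ y, (form (single i) y).toReal = (dot (cartan i) y).toReal := by
    intro y
    fin_cases i <;> simp [form, single, dot, cartanMul]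
  have h2 : inner ℝ (simpleH4 i) (simpleH4 i) = (2 : ℝ) := by
    rw [← ofCoord_single, inner_ofCoord, hf]
    fin_cases i <;> simp [dot, cartan, single]
  rw [coroot, h2, LinearMap.smul_apply, innerₛₗ_apply_apply, ← ofCoord_single, inner_ofCoord, hf]
  simp

@[simp]
theorem refl_simple_ofCoord (i : Fin 4) (x : Coord) :
    refl (simpleH4 i) (ofCoord x) = ofCoord (reflect i x) := by
  rw [refl_apply, coroot_simple_ofCoord, reflect, ofCoord_add, ofCoord_smul, ofCoord_single,
    Zphi.toReal_neg, neg_smul, sub_eq_add_neg]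

theorem toReal_withSign (e : Bool) (x : Zphi) :
    (x.withSign e).toReal = ((((if e then 1 else -1 : ℤˣ)) : ℤ) : ℝ) * x.toReal := by
  cases e <;> simp [Zphi.withSign]

/-- Signs become Booleans and even permutations become the twelve tuples, so that comparison with
`posList` is a finite check. -/
theorem mem_rootsH4_iff {v : E4} : v ∈ rootsH4 ↔ ∃ u ∈ stdSeeds, ∃ t ∈ evenTuples,
    ∃ e₀ e₁ e₂ e₃, ∀ k, v k = √2 / 2 * ((signedPerm u t e₀ e₁ e₂ e₃).get k).toReal := by
  have hseed : ∀ v : E4, v ∈ ({vec 1 0 0 0, vec (1/2) (1/2) (1/2) (1/2), vec ca (1/2) cb 0} : Set E4) ↔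
      ∃ u ∈ stdSeeds, ∀ k, v k = √2 / 2 * (u.get k).toReal := by
    intro v
    have hv : ∀ x y z w : ℝ, ∀ u : Coord, 2 * x = u.x₀.toReal → 2 * y = u.x₁.toReal →
        2 * z = u.x₂.toReal → 2 * w = u.x₃.toReal →
        (v = vec x y z w ↔ ∀ k, v k = √2 / 2 * (u.get k).toReal) := by
      intro x y z w u hx hy hz hw
      have : ∀ k, vec x y z w k = √2 / 2 * (u.get k).toReal := by
        intro k
        fin_cases k <;> simp [vec, Coord.get, ← hx, ← hy, ← hz, ← hw] <;> ring
      constructor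
      · rintro rfl
        exact this
      · intro h
        ext k
        rw [h, this]
    simp only [Set.mem_insert_iff, Set.mem_singleton_iff, stdSeeds, List.mem_cons,
      List.not_mem_nil, or_false, exists_eq_or_imp, exists_eq_left]
    rw [hv 1 0 0 0 ⟨⟨2, 0⟩, 0, 0, 0⟩, hv (1/2) (1/2) (1/2) (1/2) ⟨1, 1, 1, 1⟩,
      hv ca (1/2) cb 0 ⟨⟨0, 1⟩, 1, ⟨-1, 1⟩, 0⟩] <;> simp [ca_eq, cb_eq] <;> ring
  constructor
  · rintro ⟨u', hu', σ, hσ, e, he⟩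
    obtain ⟨u, hu, huk⟩ := (hseed u').1 hu'
    have hs : ∀ k, (if decide (e k = 1) = true then 1 else -1 : ℤˣ) = e k := by
      intro k
      rcases Int.units_eq_one_or (e k) with h | h <;> rw [h] <;> decide
    refine ⟨u, hu, _, mem_evenTuples σ (Equiv.Perm.mem_alternatingGroup.1 hσ), decide (e 0 = 1),
      decide (e 1 = 1), decide (e 2 = 1), decide (e 3 = 1), fun k => ?_⟩
    rw [he, huk]
    have h0 := toReal_withSign (decide (e 0 = 1)) (u.get (σ 0))
    have h1 := toReal_withSign (decide (e 1 = 1)) (u.get (σ 1))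
    have h2 := toReal_withSign (decide (e 2 = 1)) (u.get (σ 2))
    have h3 := toReal_withSign (decide (e 3 = 1)) (u.get (σ 3))
    rw [hs] at h0 h1 h2 h3
    fin_cases k
    · change _ = _ * ((u.get (σ 0)).withSign (decide (e 0 = 1))).toReal
      rw [h0, mul_left_comm]
      rfl
    · change _ = _ * ((u.get (σ 1)).withSign (decide (e 1 = 1))).toReal
      rw [h1, mul_left_comm]
      rfl
    · change _ = _ * ((u.get (σ 2)).withSign (decide (e 2 = 1))).toReal
      rw [h2, mul_left_comm]
      rfl
    · change _ = _ * ((u.get (σ 3)).withSign (decide (e 3 = 1))).toReal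
      rw [h3, mul_left_comm]
      rfl
  · rintro ⟨u, hu, t, ht, e₀, e₁, e₂, e₃, hv⟩
    obtain ⟨σ, hσ, h0, h1, h2, h3⟩ := exists_of_mem_evenTuples t ht
    have huk : ∀ k, (WithLp.toLp 2 fun k => √2 / 2 * (u.get k).toReal : E4) k =
      √2 / 2 * (u.get k).toReal := fun k => rfl
    refine ⟨WithLp.toLp 2 fun k => √2 / 2 * (u.get k).toReal, (hseed _).2 ⟨u, hu, huk⟩, σ,
      Equiv.Perm.mem_alternatingGroup.2 hσ, ![if e₀ then 1 else -1, if e₁ then 1 else -1,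
      if e₂ then 1 else -1, if e₃ then 1 else -1], fun k => ?_⟩
    rw [hv, huk, mul_left_comm]
    congr 1
    fin_cases k
    · change ((u.get t.1).withSign e₀).toReal = _
      rw [toReal_withSign, ← h0]
      rfl
    · change ((u.get t.2.1).withSign e₁).toReal = _
      rw [toReal_withSign, ← h1]
      rfl
    · change ((u.get t.2.2.1).withSign e₂).toReal = _
      rw [toReal_withSign, ← h2]
      rfl
    · change ((u.get t.2.2.2).withSign e₃).toReal = _
      rw [toReal_withSign, ← h3]
      rfl

theorem mem_rootsH4_iff_coord {v : E4} :
    v ∈ rootsH4 ↔ ∃ x ∈ posList, v = ofCoord x ∨ v = ofCoord (-x) := by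
  have hv : ∀ x : Coord, v = ofCoord x ↔ ∀ k, v k = √2 / 2 * ((toStd x).get k).toReal := by
    intro x
    constructor
    · rintro rfl k
      exact ofCoord_apply x k
    · intro h
      ext k
      rw [h, ofCoord_apply]
  rw [mem_rootsH4_iff]
  constructor
  · rintro ⟨u, hu, t, ht, e₀, e₁, e₂, e₃, h⟩
    obtain ⟨x, hx, he⟩ := signedPerm_mem u hu t ht e₀ e₁ e₂ e₃
    refine ⟨x, hx, he.imp (fun he => (hv x).2 ?_) (fun he => (hv (-x)).2 ?_)⟩ <;> rwa [← he]
  · rintro ⟨x, hx, he⟩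
    obtain ⟨u, hu, t, ht, e₀, e₁, e₂, e₃, h⟩ := exists_signedPerm x hx
    rcases he with he | he
    · exact ⟨u, hu, t, ht, e₀, e₁, e₂, e₃, h ▸ (hv x).1 he⟩
    -- Negative roots come from flipping all four signs.
    · refine ⟨u, hu, t, ht, !e₀, !e₁, !e₂, !e₃, ?_⟩
      have hneg : ∀ k, ((signedPerm u t (!e₀) (!e₁) (!e₂) (!e₃)).get k).toReal =
          -((signedPerm u t e₀ e₁ e₂ e₃).get k).toReal := by
        have : ∀ (e : Bool) (y : Zphi), (y.withSign (!e)).toReal = -(y.withSign e).toReal := by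
          intro e y
          cases e <;> simp [Zphi.withSign]
        intro k
        fin_cases k <;> exact this _ _
      intro k
      rw [hneg, h, he, ofCoord_neg, PiLp.neg_apply, ofCoord_apply, mul_neg]

/-! ### Positive and negative roots, and stability under the reflection group -/

theorem ofCoord_mem_cone {x : Coord} (h : ∀ i, 0 ≤ (x.get i).toReal) :
    ofCoord x ∈ Submodule.span ℝ≥0 deltaH4 :=
  Submodule.sum_mem _ fun i _ =>
    Submodule.smul_mem _ (⟨(x.get i).toReal, h i⟩ : ℝ≥0) (Submodule.subset_span ⟨i, rfl⟩)

theorem coeff_nonneg_of_mem_cone {v : E4} (h : v ∈ Submodule.span ℝ≥0 deltaH4) (i : Fin 4) :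
    0 ≤ coeff i v := by
  induction h using Submodule.span_induction with
  | mem v hv =>
    obtain ⟨k, rfl⟩ := hv
    rw [coeff_simple]
    split_ifs <;> norm_num
  | zero => rw [coeff, inner_zero_right]
  | add v v' _ _ h h' =>
    rw [coeff, inner_add_right]
    exact add_nonneg h h'
  | smul r v _ h =>
    rw [coeff, NNReal.smul_def, inner_smul_right]
    exact mul_nonneg r.2 h

theorem ofCoord_mem_posRoots {x : Coord} (hx : x ∈ posList) :
    ofCoord x ∈ posRoots rootsH4 deltaH4 :=
  ⟨mem_rootsH4_iff_coord.2 ⟨x, hx, Or.inl rfl⟩,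
    ofCoord_mem_cone fun i => Zphi.toReal_nonneg (nonneg_of_mem_posList x hx i)⟩

theorem ofCoord_neg_mem_negRoots {x : Coord} (hx : x ∈ posList) :
    ofCoord (-x) ∈ negRoots rootsH4 deltaH4 :=
  ⟨mem_rootsH4_iff_coord.2 ⟨x, hx, Or.inr rfl⟩, by
    rw [ofCoord_neg, neg_neg]
    exact (ofCoord_mem_posRoots hx).2⟩

theorem not_mem_negRoots {v : E4} (hv : v ∈ posRoots rootsH4 deltaH4) :
    v ∉ negRoots rootsH4 deltaH4 := by
  intro hn
  have h0 : ∀ i, coeff i v = 0 := by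
    intro i
    have h1 := coeff_nonneg_of_mem_cone hv.2 i
    have h2 := coeff_nonneg_of_mem_cone hn.2 i
    rw [coeff, inner_neg_right, Left.nonneg_neg_iff] at h2
    exact le_antisymm h2 h1
  obtain ⟨x, hx, h⟩ := mem_rootsH4_iff_coord.1 hv.1
  have hx0 : ∀ i, x.get i = 0 := by
    intro i
    rw [← Zphi.toReal_eq_zero, ← coeff_ofCoord]
    rcases h with rfl | rfl
    · exact h0 i
    · have := h0 i
      rw [ofCoord_neg, coeff, inner_neg_right, neg_eq_zero] at this
      exact this
  apply height_of_mem_posList x hx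
  change x.get 0 + x.get 1 + x.get 2 + x.get 3 = 0
  rw [hx0, hx0, hx0, hx0]
  rfl

theorem mem_posRoots_iff {v : E4} :
    v ∈ posRoots rootsH4 deltaH4 ↔ ∃ x ∈ posList, v = ofCoord x := by
  constructor
  · intro hv
    obtain ⟨x, hx, h | h⟩ := mem_rootsH4_iff_coord.1 hv.1
    · exact ⟨x, hx, h⟩
    · exact absurd (h ▸ ofCoord_neg_mem_negRoots hx) (not_mem_negRoots hv)
  · rintro ⟨x, hx, rfl⟩
    exact ofCoord_mem_posRoots hx

theorem mem_rootsH4_iff_pos {v : E4} :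
    v ∈ rootsH4 ↔ v ∈ posRoots rootsH4 deltaH4 ∨ -v ∈ posRoots rootsH4 deltaH4 := by
  simp only [mem_rootsH4_iff_coord, mem_posRoots_iff, ofCoord_neg, neg_eq_iff_eq_neg, ← exists_or,
    ← and_or_left]

theorem neg_mem_rootsH4 {v : E4} (hv : v ∈ rootsH4) : -v ∈ rootsH4 := by
  rw [mem_rootsH4_iff_pos] at hv ⊢
  rw [neg_neg]
  exact hv.symm

theorem refl_simple_mem (i : Fin 4) {v : E4} (hv : v ∈ rootsH4) :
    refl (simpleH4 i) v ∈ rootsH4 := by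
  have key : ∀ x ∈ posList, ofCoord (reflect i x) ∈ rootsH4 := by
    intro x hx
    rcases reflect_mem_posList x hx i with rfl | h
    · rw [← refl_simple_ofCoord, ofCoord_single, refl_self, ← ofCoord_single]
      exact neg_mem_rootsH4 (mem_rootsH4_iff_coord.2 ⟨_, hx, Or.inl rfl⟩)
    · exact mem_rootsH4_iff_coord.2 ⟨_, h, Or.inl rfl⟩
  obtain ⟨x, hx, rfl | rfl⟩ := mem_rootsH4_iff_coord.1 hv
  · rw [refl_simple_ofCoord]
    exact key x hx
  · rw [ofCoord_neg, map_neg, refl_simple_ofCoord]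
    exact neg_mem_rootsH4 (key x hx)

theorem refl_map {E : Type*} [NormedAddCommGroup E] [InnerProductSpace ℝ E] (w : E ≃ₗᵢ[ℝ] E)
    (α v : E) : refl (w α) (w v) = w (refl α v) := by
  simp [refl_apply, coroot]

/-- Induction on `size`, conjugating by a simple reflection: `s_β = s_i s_{s_i β} s_i`. -/
theorem refl_posList_mem {x : Coord} (hx : x ∈ posList) {v : E4} (hv : v ∈ rootsH4) :
    refl (ofCoord x) v ∈ rootsH4 := by
  induction hn : size x using Nat.strong_induction_on generalizing x v with
  | _ n ih =>
    rcases exists_size_lt x hx with ⟨i, rfl⟩ | ⟨i, hi, hlt⟩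
    · rw [ofCoord_single]
      exact refl_simple_mem i hv
    · have h := refl_map (refl (simpleH4 i)) (ofCoord (reflect i x)) (refl (simpleH4 i) v)
      rw [← refl_simple_ofCoord, refl_refl, refl_refl] at h
      rw [h, refl_simple_ofCoord]
      exact refl_simple_mem i (ih _ (hn ▸ hlt) hi (refl_simple_mem i hv) rfl)

theorem refl_neg_eq {E : Type*} [NormedAddCommGroup E] [InnerProductSpace ℝ E] (α v : E) :
    refl (-α) v = refl α v := by
  simp [refl_apply, coroot]

theorem finite_rootsH4 : rootsH4.Finite := by
  refine (((posList.toFinset.image ofCoord) ∪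
    (posList.toFinset.image fun x => ofCoord (-x))).finite_toSet).subset fun v hv => ?_
  obtain ⟨x, hx, h⟩ := mem_rootsH4_iff_coord.1 hv
  simp only [Finset.coe_union, Finset.coe_image, Set.mem_union, Set.mem_image, Finset.mem_coe,
    List.mem_toFinset]
  exact h.imp (fun h => ⟨x, hx, h.symm⟩) (fun h => ⟨x, hx, h.symm⟩)

theorem apply_mem_rootsH4 (u : E4 ≃ₗᵢ[ℝ] E4) (hu : u ∈ weylGroup rootsH4) :
    ∀ v ∈ rootsH4, u v ∈ rootsH4 := by
  refine Subgroup.closure_induction (p := fun u _ => ∀ v ∈ rootsH4, u v ∈ rootsH4) ?_ ?_ ?_ ?_ hu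
  · rintro _ ⟨α, hα, rfl⟩ v hv
    obtain ⟨x, hx, rfl | rfl⟩ := mem_rootsH4_iff_coord.1 hα
    · exact refl_posList_mem hx hv
    · rw [ofCoord_neg, refl_neg_eq]
      exact refl_posList_mem hx hv
  · exact fun v hv => hv
  · exact fun x y _ _ hx hy v hv => hx _ (hy _ hv)
  · intro x _ hx v hv
    have : Set.BijOn x rootsH4 rootsH4 :=
      (Set.Finite.injOn_iff_bijOn_of_mapsTo finite_rootsH4 hx).1 x.injective.injOn
    obtain ⟨w, hw, rfl⟩ := this.surjOn hv
    simpa using hw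

/-- Such a `u` permutes the positive roots, hence fixes their sum. It therefore permutes the simple
roots, which are the positive roots having product 2 with that sum. Being an isometry it induces a
diagram symmetry, and this is the identity. -/
theorem rigid_H4 (u : E4 ≃ₗᵢ[ℝ] E4) (hu : u ∈ weylGroup rootsH4)
    (h : ∀ i, u (simpleH4 i) ∈ posRoots rootsH4 deltaH4) : u = 1 := by
  classical
  have hpos : ∀ x ∈ posList, u (ofCoord x) ∈ posRoots rootsH4 deltaH4 := by
    refine fun x hx => ⟨apply_mem_rootsH4 u hu _ (ofCoord_mem_posRoots hx).1, ?_⟩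
    rw [ofCoord, map_sum]
    refine Submodule.sum_mem _ fun i _ => ?_
    rw [map_smul]
    exact Submodule.smul_mem _
      (⟨_, Zphi.toReal_nonneg (nonneg_of_mem_posList x hx i)⟩ : ℝ≥0) (h i).2
  have hsum : ∀ l : List Coord, l.Nodup →
      ofCoord (l.foldr (· + ·) ⟨0, 0, 0, 0⟩) = ∑ v ∈ (l.toFinset.image ofCoord), v := by
    intro l hl
    rw [Finset.sum_image ofCoord_injective.injOn]
    induction l with
    | nil => simp [ofCoord, Fin.sum_univ_four, Coord.get]
    | cons x l ih =>
      rw [List.nodup_cons] at hl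
      rw [List.toFinset_cons, Finset.sum_insert (by simpa using hl.1), List.foldr_cons,
        ofCoord_add, ih hl.2]
  have himage : (posList.toFinset.image ofCoord).image u = posList.toFinset.image ofCoord := by
    refine Finset.eq_of_subset_of_card_le (fun v hv => ?_)
      (Finset.card_image_of_injective _ u.injective).ge
    simp only [Finset.mem_image, List.mem_toFinset, exists_exists_and_eq_and] at hv
    obtain ⟨x, hx, rfl⟩ := hv
    obtain ⟨y, hy, hxy⟩ := mem_posRoots_iff.1 (hpos x hx)
    rw [hxy]
    exact Finset.mem_image_of_mem _ (List.mem_toFinset.2 hy)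
  have hfix : u (ofCoord posSum) = ofCoord posSum := by
    rw [posSum, hsum _ nodup_posList, map_sum]
    conv_rhs => rw [← himage, Finset.sum_image u.injective.injOn]
  have hsimple : ∀ i, ∃ k, u (simpleH4 i) = simpleH4 k := by
    intro i
    obtain ⟨x, hx, hix⟩ := mem_posRoots_iff.1 (h i)
    have : form posSum x = ⟨2, 0⟩ := by
      apply Zphi.toReal_injective
      rw [← inner_ofCoord, ← hix, ← hfix, LinearIsometryEquiv.inner_map_map, ← ofCoord_single,
        inner_ofCoord, form_posSum_single]
    obtain ⟨k, rfl⟩ := exists_of_form_posSum x hx this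
    exact ⟨k, by rw [hix, ofCoord_single]⟩
  choose f hf using hsimple
  have hcart : ∀ i k, (cartan (f i)).get (f k) = (cartan i).get k := by
    have hform : ∀ i k, (cartan i).get k = form (single i) (single k) := by decide +kernel
    intro i k
    apply Zphi.toReal_injective
    rw [hform, hform, ← inner_ofCoord, ← inner_ofCoord, ofCoord_single, ofCoord_single,
      ofCoord_single, ofCoord_single, ← hf, ← hf, LinearIsometryEquiv.inner_map_map]
  exact isometry_ext fun i => by
    rw [hf, eq_self_of_cartan f hcart i]
    rfl

theorem isSimpleSystem_H4 : IsSimpleSystem rootsH4 simpleH4 where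
  finite := finite_rootsH4
  mem i := deltaH4_subset ⟨i, rfl⟩
  neg_mem _ := neg_mem_rootsH4
  refl_mem α hα v hv :=
    apply_mem_rootsH4 (refl α) (Subgroup.subset_closure ⟨α, hα, rfl⟩) v hv
  pos_or_neg v hv := (mem_rootsH4_iff_pos.1 hv).imp id fun h => ⟨hv, h.2⟩
  not_neg _ := not_mem_negRoots
  refl_pos i v hv hne := by
    obtain ⟨x, hx, rfl⟩ := mem_posRoots_iff.1 hv
    rcases reflect_mem_posList x hx i with rfl | h
    · exact absurd (ofCoord_single i) hne
    · rw [refl_simple_ofCoord]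
      exact ofCoord_mem_posRoots h
  rigid := rigid_H4

/-- The entries of the Coxeter matrix of type `H₄`. -/
def coxeterH4 (i j : Fin 4) : ℕ :=
  if (cartan i).get j = ⟨0, -1⟩ then 5 else if (cartan i).get j = ⟨-1, 0⟩ then 3 else 2

/-- The roots `altRoot` in coordinates. -/
def altCoord : ℕ → Fin 4 → Fin 4 → Coord
  | 0, i, _ => single i
  | k + 1, i, j => reflect i (altCoord k j i)

theorem ofCoord_altCoord (k : ℕ) (i j : Fin 4) :
    ofCoord (altCoord k i j) = altRoot simpleH4 k i j := by
  induction k generalizing i j with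
  | zero => exact ofCoord_single i
  | succ k ih => rw [altCoord, ← refl_simple_ofCoord, ih, altRoot]

theorem prod_refl_ofCoord (l : List (Fin 4)) (x : Coord) :
    (l.map fun k => refl (simpleH4 k)).prod (ofCoord x) = ofCoord (applyWord l x) := by
  induction l with
  | nil => rfl
  | cons i l ih =>
    change refl (simpleH4 i) ((l.map fun k => refl (simpleH4 k)).prod (ofCoord x)) = _
    rw [ih, refl_simple_ofCoord]
    rfl

theorem applyWord_altWord : ∀ i j, i ≠ j → ∀ k,
    applyWord (altWord (coxeterH4 i j) i j) (single k) =
      applyWord (altWord (coxeterH4 i j) j i) (single k) := by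
  decide +kernel

theorem altCoord_nonneg : ∀ i j, i ≠ j → ∀ k < coxeterH4 i j,
    ((altCoord k i j).get i).nonneg = true ∧ ((altCoord k i j).get j).nonneg = true ∧
      ∀ l, l ≠ i → l ≠ j → (altCoord k i j).get l = 0 := by
  decide +kernel

theorem isCoxeterMatrix_H4 : IsCoxeterMatrix simpleH4 coxeterH4 where
  pos := by decide +kernel
  symm := by decide +kernel
  braid i j hij := isometry_ext fun k => by
    rw [← ofCoord_single, prod_refl_ofCoord, prod_refl_ofCoord, applyWord_altWord i j hij]
  cone i j hij k hk := by
    obtain ⟨hi, hj, hl⟩ := altCoord_nonneg i j hij k hk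
    rw [← ofCoord_altCoord, ofCoord]
    refine Submodule.sum_mem _ fun l _ => ?_
    by_cases hli : l = i
    · subst hli
      exact Submodule.smul_mem _ (⟨_, Zphi.toReal_nonneg hi⟩ : ℝ≥0)
        (Submodule.subset_span (by simp))
    by_cases hlj : l = j
    · subst hlj
      exact Submodule.smul_mem _ (⟨_, Zphi.toReal_nonneg hj⟩ : ℝ≥0)
        (Submodule.subset_span (by simp))
    rw [hl l hli hlj, Zphi.toReal_zero, zero_smul]
    exact Submodule.zero_mem _

open Coord

/-! ### The three regions in coordinates -/

/-- The values of `2 χ_j` at the simple roots. -/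
def twoChi : Fin 3 → Coord
  | 0 => ⟨⟨5, -3⟩, ⟨-3, 2⟩, ⟨-3, 2⟩, ⟨0, 0⟩⟩
  | 1 => ⟨⟨2, -1⟩, ⟨2, -1⟩, ⟨-3, 2⟩, ⟨0, 0⟩⟩
  | 2 => ⟨⟨1, 0⟩, ⟨0, 0⟩, ⟨2, -1⟩, ⟨2, -1⟩⟩

/-- A word for an element of the region. -/
def startWord : Fin 3 → List (Fin 4)
  | 0 => [3, 2, 3, 1, 2, 3, 1, 2, 3, 0, 1, 2, 3, 0, 1, 2, 3, 0, 1, 2, 3, 0, 1, 2, 3, 0, 1, 2, 3, 0,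
      1, 2, 3, 0, 1, 2, 1]
  | 1 => [2, 3, 2, 3, 1, 2, 3, 0, 1, 2, 3, 0, 1, 2, 3, 0, 1, 2, 3, 0, 1, 2, 3, 0, 1, 2, 3, 0, 1, 2,
      3, 0, 1, 2, 3, 0, 1, 2, 3, 0, 1, 2, 3, 0, 1, 2, 0, 1, 0]
  | 2 => [1, 2, 3, 1, 2, 3, 1, 2, 3, 0, 1, 2, 3, 0, 1, 2, 3, 0, 1, 2, 3, 0, 1, 2, 3, 0, 1, 2, 3, 0,
      1, 2, 3, 0, 1, 2, 3, 0, 1, 2, 3, 0, 1, 2, 3, 0, 1, 2, 0]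

/-- The images of the simple roots under the inverse of an element of the Weyl group, in
coordinates. -/
@[ext]
structure Code where
  y₀ : Coord
  y₁ : Coord
  y₂ : Coord
  y₃ : Coord
  deriving DecidableEq

namespace Code

/-- The image of the `i`-th simple root. -/
def get (C : Code) : Fin 4 → Coord
  | 0 => C.y₀
  | 1 => C.y₁
  | 2 => C.y₂
  | 3 => C.y₃

/-- The code of `s_i w`, for `C` the code of `w`. -/
def move (i : Fin 4) (C : Code) : Code :=
  let y := C.get i
  let r := cartan i
  ⟨C.y₀ + -r.x₀ • y, C.y₁ + -r.x₁ • y, C.y₂ + -r.x₂ • y, C.y₃ + -r.x₃ • y⟩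

/-- The values of `2 w χ` at the simple roots. -/
def weight (X : Coord) (C : Code) : Coord :=
  ⟨dot C.y₀ X, dot C.y₁ X, dot C.y₂ X, dot C.y₃ X⟩

/-- The code of the product of a word. -/
def ofWord (l : List (Fin 4)) : Code :=
  let r := l.reverse
  ⟨applyWord r (single 0), applyWord r (single 1), applyWord r (single 2), applyWord r (single 3)⟩

end Code

/-- Whether a reflection in a simple root where `2 w χ` takes the value `x` preserves the region. -/
def Zphi.isEdge (x : Zphi) : Bool := !(decide (x = 0) || decide (x = 1) || decide (x = -1))

/-- The codes of the neighbours of an element in the region. -/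
def Code.neighbours (X : Coord) (C : Code) : List Code :=
  ((List.finRange 4).filter fun i => ((C.weight X).get i).isEdge).map fun i => C.move i

/-- Breadth first search. -/
def explore (X : Coord) : ℕ → List Code → List Code → List Code
  | 0, seen, _ => seen
  | n + 1, seen, frontier =>
    let new := ((frontier.flatMap (Code.neighbours X)).filter fun C => decide (C ∉ seen)).dedup
    explore X n (new ++ seen) new

/-- The codes of the elements of the region. -/
def codes (j : Fin 3) : List Code :=
  -- The depth 16 is not justified here: that the search is exhaustive follows from the closure
  -- under moves verified in `codes_spec`.
  explore (twoChi j) 16 [Code.ofWord (startWord j)] [Code.ofWord (startWord j)]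

/-- A common multiple of the values of `2 w χ` at the simple roots. -/
def scale : Fin 3 → ℤ
  | 0 => 150480
  | 1 => 55
  | 2 => 1980

/-- The quotient `n / x`, when it belongs to `ℤ[φ]`. -/
def Zphi.quot (n : ℤ) (x : Zphi) : Zphi :=
  -- The denominator is the norm of `x`, and `(a + b) - bφ` is its conjugate. Integer division may
  -- round; `codes_spec` checks exactness wherever the quotient is used.
  let m := n / (x.a * x.a + x.a * x.b - x.b * x.b)
  ⟨m * (x.a + x.b), -(m * x.b)⟩

/-- The values of `2 s_i w χ` at the simple roots, for `μ` those of `2 w χ`. -/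
def reflWeight (i : Fin 4) (μ : Coord) : Coord := μ + -(μ.get i) • cartan i

/-- The multiple by `n` of the action of the `i`-th simple reflection on a multiple of a basis
vector, given by its weight. -/
def opTerm (n : ℤ) (i : Fin 4) (t : Zphi × Coord) : List (Zphi × Coord) :=
  let x := t.2.get i
  let q := Zphi.quot n x
  if x.isEdge then [(t.1 * q, t.2), (t.1 * (⟨n, 0⟩ + q), reflWeight i t.2)] else [(t.1 * q, t.2)]

/-- Add a term to a linear combination of basis vectors. -/
def addTerm (t : Zphi × Coord) : List (Zphi × Coord) → List (Zphi × Coord)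
  | [] => [t]
  | t' :: l => if t.2 = t'.2 then (t.1 + t'.1, t'.2) :: l else t' :: addTerm t l

/-- The multiple by `n` of the action of the `i`-th simple reflection on a linear combination of
basis vectors. -/
def opList (n : ℤ) (i : Fin 4) (l : List (Zphi × Coord)) : List (Zphi × Coord) :=
  (l.flatMap (opTerm n i)).foldr addTerm []

/-- The action of a word of simple reflections, each multiplied by `n`, on a basis vector. -/
def opWord (n : ℤ) (w : List (Fin 4)) (μ : Coord) : List (Zphi × Coord) :=
  w.foldr (opList n) [(1, μ)]

/-- The braid relation for two simple reflections, on a basis vector. -/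
def braidCheck (n : ℤ) (i k : Fin 4) (μ : Coord) : Bool :=
  (((opWord n (altWord (coxeterH4 i k) i k) μ).map fun t => (-t.1, t.2)).foldr addTerm
    (opWord n (altWord (coxeterH4 i k) k i) μ)).all fun t => decide (t.1 = 0)

/-- The index of the simple root in `Z(χ_j)`. -/
def zIndex : Fin 3 → Fin 4
  | 0 => 3
  | 1 => 3
  | 2 => 1

/-- The coordinates of the elements of `P(χ_j)`. -/
def pCoord : Fin 3 → Fin 6 → Coord
  | 0, 0 => ⟨0, ⟨0, 1⟩, ⟨1, 1⟩, ⟨0, 1⟩⟩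
  | 0, 1 => ⟨0, ⟨0, 1⟩, ⟨1, 1⟩, ⟨1, 1⟩⟩
  | 0, 2 => ⟨1, 1, ⟨1, 1⟩, ⟨0, 1⟩⟩
  | 0, 3 => ⟨1, 1, ⟨1, 1⟩, ⟨1, 1⟩⟩
  | 0, 4 => ⟨⟨0, 1⟩, ⟨0, 1⟩, ⟨0, 1⟩, 1⟩
  | 0, 5 => ⟨⟨0, 1⟩, ⟨0, 1⟩, ⟨0, 1⟩, ⟨0, 1⟩⟩
  | 1, 0 => ⟨0, 1, ⟨1, 1⟩, ⟨0, 1⟩⟩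
  | 1, 1 => ⟨0, 1, ⟨1, 1⟩, ⟨1, 1⟩⟩
  | 1, 2 => ⟨0, ⟨0, 1⟩, ⟨0, 1⟩, 1⟩
  | 1, 3 => ⟨0, ⟨0, 1⟩, ⟨0, 1⟩, ⟨0, 1⟩⟩
  | 1, 4 => ⟨1, 1, 1, 0⟩
  | 1, 5 => ⟨1, 1, 1, ⟨0, 1⟩⟩
  | 2, 0 => ⟨1, 0, 0, 0⟩
  | 2, 1 => ⟨1, 1, 0, 0⟩
  | 2, 2 => ⟨0, 0, 1, ⟨0, 1⟩⟩
  | 2, 3 => ⟨0, 1, 1, ⟨0, 1⟩⟩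
  | 2, 4 => ⟨0, 0, ⟨0, 1⟩, 1⟩
  | 2, 5 => ⟨0, ⟨0, 1⟩, ⟨0, 1⟩, 1⟩

/-- The coefficients of the simple roots with respect to the basis consisting of the element of
`Z(χ_j)` and of `β_j^1`, `β_j^3` and `β_j^5`. -/
def simpleCoeff : Fin 3 → Fin 4 → Coord
  | 0, 0 => ⟨0, ⟨1, -1⟩, ⟨2, -1⟩, ⟨2, -1⟩⟩
  | 0, 1 => ⟨0, ⟨-1, 1⟩, ⟨-1, 0⟩, ⟨-1, 1⟩⟩
  | 0, 2 => ⟨⟨1, -1⟩, 0, ⟨-1, 1⟩, ⟨-2, 1⟩⟩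
  | 0, 3 => ⟨1, 0, 0, 0⟩
  | 1, 0 => ⟨⟨-1, 1⟩, 0, ⟨1, -1⟩, 1⟩
  | 1, 1 => ⟨0, ⟨1, -1⟩, 1, 0⟩
  | 1, 2 => ⟨⟨1, -1⟩, ⟨-1, 1⟩, ⟨-2, 1⟩, 0⟩
  | 1, 3 => ⟨1, 0, 0, 0⟩
  | 2, 0 => ⟨0, 1, 0, 0⟩
  | 2, 1 => ⟨1, 0, 0, 0⟩
  | 2, 2 => ⟨0, 0, ⟨1, -1⟩, 1⟩
  | 2, 3 => ⟨0, 0, 1, ⟨1, -1⟩⟩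

/-- A character vanishing at the first basis vector and equal to `1/2` at the other three has twice
its value at a simple root equal to the sum of the last three coefficients. This is what makes `χ_j`
unique. -/
theorem simpleCoeff_spec : ∀ j i,
    (simpleCoeff j i).x₀ • single (zIndex j) + (simpleCoeff j i).x₁ • pCoord j 0 +
      (simpleCoeff j i).x₂ • pCoord j 2 + (simpleCoeff j i).x₃ • pCoord j 4 = single i ∧
    (simpleCoeff j i).x₁ + (simpleCoeff j i).x₂ + (simpleCoeff j i).x₃ = (twoChi j).get i := by
  decide +kernel

theorem dot_twoChi_eq_zero_iff : ∀ j, ∀ x ∈ posList,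
    dot x (twoChi j) = 0 ↔ x = single (zIndex j) := by
  decide +kernel

theorem dot_twoChi_eq_one_iff : ∀ j, ∀ x ∈ posList,
    (dot x (twoChi j) = 1 ↔ ∃ k, x = pCoord j k) ∧ dot (-x) (twoChi j) ≠ 1 := by
  decide +kernel

theorem pCoord_mem_posList : ∀ j k, pCoord j k ∈ posList := by
  decide +kernel

theorem pCoord_injective : ∀ j k k', pCoord j k = pCoord j k' → k = k' := by
  decide +kernel

theorem signs_eq : ∀ j k, signs j k = -1 ∨ signs j k = 1 := by
  decide +kernel

theorem applyWord_startWord_zIndex : ∀ j,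
    applyWord (startWord j) (single (zIndex j)) ∈ posList := by
  decide +kernel

theorem applyWord_startWord_pCoord : ∀ j k,
    (signs j k = -1 → -applyWord (startWord j) (pCoord j k) ∈ posList) ∧
      (signs j k ≠ -1 → applyWord (startWord j) (pCoord j k) ∈ posList) := by
  decide +kernel

/-- The properties of the region which are checked by computation. -/
theorem codes_spec : ∀ j, (codes j).length = dims j ∧
    ((codes j).map (Code.weight (twoChi j))).Nodup ∧ ∀ C ∈ codes j,
      (∀ i, (((C.weight (twoChi j)).get i).isEdge = true → C.move i ∈ codes j) ∧
        (C.weight (twoChi j)).get i ≠ 0 ∧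
        (dot (weight i) (C.weight (twoChi j))).isNeg = true ∧
        Zphi.quot (scale j) ((C.weight (twoChi j)).get i) * (C.weight (twoChi j)).get i =
          ⟨scale j, 0⟩) ∧
      (∀ x ∈ rankTwoList, dot x (C.weight (twoChi j)) ≠ 0) ∧
      ∀ i k, i < k → braidCheck (scale j) i k (C.weight (twoChi j)) = true := by
  -- All facts specific to the three regions are checked in this one evaluation, so that the search
  -- and the operators are computed by the kernel in exact integer arithmetic.
  decide +kernel

/-- The weight of `s_i w` depends only on that of `w`, so the braid relations can be tested on
weights without carrying codes. -/
theorem move_weight (X : Coord) (C : Code) (i : Fin 4) :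
    (C.move i).weight X = reflWeight i (C.weight X) := by
  have h : ∀ (z : Zphi) (y y' : Coord), dot (y + z • y') X = dot y X + dot y' X * z := by
    intro z y y'
    apply Zphi.toReal_injective
    simp only [toReal_dot, Zphi.toReal_add, Zphi.toReal_mul, get_add, get_smul, Fin.sum_univ_four]
    ring
  have hneg : ∀ z z' : Zphi, z * -z' = -z * z' := by
    intro z z'
    apply Zphi.toReal_injective
    simp
  refine Coord.ext_get fun k => ?_
  rw [reflWeight, get_add, get_smul, ← hneg]
  have hw : (C.weight X).get i = dot (C.get i) X := by fin_cases i <;> rfl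
  rw [hw]
  fin_cases k <;> exact h _ _ _

open Coord

/-! ### Characters with values in `ℤ[φ] / 2` -/

/-- The values of `2 χ` at the simple roots are given by `μ`. -/
def HasWeight (χ : Character E4) (μ : Coord) : Prop :=
  ∀ i, ev χ (simpleH4 i) = ((μ.get i).toReal : ℂ) / 2

theorem HasWeight.ev_ofCoord {χ : Character E4} {μ : Coord} (h : HasWeight χ μ) (x : Coord) :
    ev χ (ofCoord x) = ((dot x μ).toReal : ℂ) / 2 := by
  rw [ofCoord, ev_sum, toReal_dot]
  simp only [ev_smul, h _, Complex.ofReal_sum, Complex.ofReal_mul, Finset.sum_div, mul_div_assoc]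

theorem HasWeight.character_unique {χ χ' : Character E4} {μ : Coord} (h : HasWeight χ μ)
    (h' : HasWeight χ' μ) : χ = χ' :=
  character_ext fun i => by rw [h i, h' i]

theorem HasWeight.unique {χ : Character E4} {μ ν : Coord} (h : HasWeight χ μ)
    (h' : HasWeight χ ν) : μ = ν := by
  refine Coord.ext_get fun i => Zphi.toReal_injective ?_
  have := (h i).symm.trans (h' i)
  rw [div_left_inj' two_ne_zero] at this
  exact_mod_cast this

theorem exists_hasWeight (μ : Coord) : ∃ χ : Character E4, HasWeight χ μ := by
  refine ⟨Module.Dual.baseChange ℂ (simpleBasis.constr ℝ fun i => (μ.get i).toReal / 2),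
    fun i => ?_⟩
  rw [ev, Module.Dual.baseChange_apply_tmul, ← simpleBasis_apply, Module.Basis.constr_basis]
  simp

theorem half_eq_zero_iff {x : Zphi} : ((x.toReal : ℂ) / 2 = 0) ↔ x = 0 := by
  rw [div_eq_zero_iff, or_iff_left two_ne_zero, Complex.ofReal_eq_zero, Zphi.toReal_eq_zero]

theorem half_eq_iff {x : Zphi} : ((x.toReal : ℂ) / 2 = 1 / 2) ↔ x = 1 := by
  rw [div_left_inj' two_ne_zero, Complex.ofReal_eq_one, ← Zphi.toReal_one,
    Zphi.toReal_injective.eq_iff]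

theorem half_eq_neg_iff {x : Zphi} : ((x.toReal : ℂ) / 2 = -(1 / 2)) ↔ x = -1 := by
  rw [← neg_div, div_left_inj' two_ne_zero, ← Zphi.toReal_injective.eq_iff, Zphi.toReal_neg,
    Zphi.toReal_one]
  norm_cast

theorem paramH4_apply (v : E4) : paramH4 v = 1 / 2 := rfl

theorem isEdge_iff {χ : Character E4} {μ : Coord} (h : HasWeight χ μ) (i : Fin 4) :
    (μ.get i).isEdge = true ↔ ev χ (simpleH4 i) ≠ 0 ∧ ev χ (simpleH4 i) ≠ paramH4 (simpleH4 i) ∧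
      ev χ (simpleH4 i) ≠ -paramH4 (simpleH4 i) := by
  rw [paramH4_apply, h i, Ne, Ne, Ne, half_eq_zero_iff, half_eq_iff, half_eq_neg_iff,
    Zphi.isEdge]
  simp [and_assoc]

/-! ### The characters `χ_j` -/

theorem ofCoord_eq_vec (x : Coord) {p q r t : ℝ} (hp : ((toStd x).x₀).toReal = 2 * p)
    (hq : ((toStd x).x₁).toReal = 2 * q) (hr : ((toStd x).x₂).toReal = 2 * r)
    (ht : ((toStd x).x₃).toReal = 2 * t) : ofCoord x = vec p q r t := by
  ext k
  rw [ofCoord_apply]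
  fin_cases k
  · simp [Coord.get, hp, vec]; ring
  · simp [Coord.get, hq, vec]; ring
  · simp [Coord.get, hr, vec]; ring
  · simp [Coord.get, ht, vec]; ring

theorem ofCoord_pCoord (j : Fin 3) (k : Fin 6) : ofCoord (pCoord j k) = pRoots j k := by
  have h2 := Real.goldenRatio_sq
  fin_cases j <;> fin_cases k <;>
  (refine ofCoord_eq_vec _ ?_ ?_ ?_ ?_ <;>
    simp only [toStd, pCoord, Zphi.toReal_add, Zphi.toReal_mul, Zphi.toReal_mk, Zphi.toReal_neg,
      Zphi.toReal_zero, Zphi.toReal_one, ca_eq, cb_eq] <;> push_cast <;>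
    generalize Real.goldenRatio = φ at * <;>
    linarith)

theorem zRoot_eq (j : Fin 3) : zRoot j = simpleH4 (zIndex j) := by
  fin_cases j <;> rfl

theorem hasWeight_of_sets {j : Fin 3} {χ : Character E4}
    (hz : zeroSet rootsH4 deltaH4 χ = {zRoot j})
    (hp : paramSet rootsH4 paramH4 χ = Set.range (pRoots j)) : HasWeight χ (twoChi j) := by
  have h0 : ev χ (simpleH4 (zIndex j)) = 0 := by
    have : zRoot j ∈ zeroSet rootsH4 deltaH4 χ := hz ▸ rfl
    rw [← zRoot_eq]
    exact this.2
  have h1 : ∀ k, ev χ (ofCoord (pCoord j k)) = 1 / 2 := by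
    intro k
    have : pRoots j k ∈ paramSet rootsH4 paramH4 χ := hp ▸ ⟨k, rfl⟩
    rw [ofCoord_pCoord]
    exact this.2
  intro i
  obtain ⟨hs, ht⟩ := simpleCoeff_spec j i
  rw [← ofCoord_single, ← hs, ← ht]
  simp only [ofCoord_add, ofCoord_smul, ev_add, ev_smul, h1, ofCoord_single, h0, Zphi.toReal_add]
  push_cast
  ring

theorem zeroSet_eq {j : Fin 3} {χ : Character E4} (h : HasWeight χ (twoChi j)) :
    zeroSet rootsH4 deltaH4 χ = {zRoot j} := by
  ext v
  rw [Set.mem_singleton_iff, zRoot_eq, ← ofCoord_single]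
  constructor
  · rintro ⟨hv, h0⟩
    obtain ⟨x, hx, rfl⟩ := mem_posRoots_iff.1 hv
    rw [h.ev_ofCoord, half_eq_zero_iff] at h0
    rw [(dot_twoChi_eq_zero_iff j x hx).1 h0]
  · rintro rfl
    refine ⟨ofCoord_mem_posRoots (single_mem_posList _), ?_⟩
    rw [h.ev_ofCoord, half_eq_zero_iff]
    exact (dot_twoChi_eq_zero_iff j _ (single_mem_posList _)).2 rfl

theorem paramSet_eq {j : Fin 3} {χ : Character E4} (h : HasWeight χ (twoChi j)) :
    paramSet rootsH4 paramH4 χ = Set.range (pRoots j) := by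
  ext v
  constructor
  · rintro ⟨hv, h1⟩
    rw [paramH4_apply] at h1
    obtain ⟨x, hx, rfl | rfl⟩ := mem_rootsH4_iff_coord.1 hv
    · rw [h.ev_ofCoord, half_eq_iff] at h1
      obtain ⟨k, rfl⟩ := ((dot_twoChi_eq_one_iff j x hx).1).1 h1
      exact ⟨k, (ofCoord_pCoord j k).symm⟩
    · rw [h.ev_ofCoord, half_eq_iff] at h1
      exact absurd h1 (dot_twoChi_eq_one_iff j x hx).2
  · rintro ⟨k, rfl⟩
    have hk := pCoord_mem_posList j k
    refine ⟨?_, ?_⟩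
    · rw [← ofCoord_pCoord]
      exact (ofCoord_mem_posRoots hk).1
    · rw [← ofCoord_pCoord, h.ev_ofCoord, paramH4_apply, half_eq_iff]
      exact ((dot_twoChi_eq_one_iff j _ hk).1).2 ⟨k, rfl⟩

/-- The set `J_j` of the elements of `P(χ_j)` with negative sign. -/
def negSet (j : Fin 3) : Set E4 := {v | ∃ k, signs j k = -1 ∧ v = pRoots j k}

theorem pRoots_mem_negSet_iff {j : Fin 3} {k : Fin 6} :
    pRoots j k ∈ negSet j ↔ signs j k = -1 := by
  constructor
  · rintro ⟨k', hk', h⟩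
    rw [← ofCoord_pCoord, ← ofCoord_pCoord] at h
    rwa [pCoord_injective j k k' (ofCoord_injective h)]
  · exact fun h => ⟨k, h, rfl⟩

/-- The region of `(χ_j, J_j)`. -/
abbrev regionH4 (χ : Character E4) (j : Fin 3) : Set (weylGroup rootsH4) :=
  region rootsH4 (Set.range simpleH4) paramH4 χ (negSet j)

theorem negSet_subset {j : Fin 3} {χ : Character E4} (h : HasWeight χ (twoChi j)) :
    negSet j ⊆ paramSet rootsH4 paramH4 χ := by
  rintro _ ⟨k, -, rfl⟩
  rw [paramSet_eq h]
  exact ⟨k, rfl⟩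

theorem wordProd_ofCoord (l : List (Fin 4)) (x : Coord) :
    ((isSimpleSystem_H4.wordProd l : weylGroup rootsH4) : E4 ≃ₗᵢ[ℝ] E4) (ofCoord x) =
      ofCoord (applyWord l x) := by
  rw [IsSimpleSystem.coe_wordProd, prod_refl_ofCoord]

theorem wordProd_inv (l : List (Fin 4)) : (isSimpleSystem_H4.wordProd l)⁻¹ = isSimpleSystem_H4.wordProd l.reverse := by
  induction l with
  | nil => simp
  | cons i l ih =>
    rw [IsSimpleSystem.wordProd_cons, mul_inv_rev, ih, List.reverse_cons,
      IsSimpleSystem.wordProd_append, IsSimpleSystem.gen_inv]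
    simp

theorem wordProd_startWord_mem {j : Fin 3} {χ : Character E4} (h : HasWeight χ (twoChi j)) :
    isSimpleSystem_H4.wordProd (startWord j) ∈ regionH4 χ j := by
  refine ⟨?_, ?_, ?_⟩
  · rw [Set.eq_empty_iff_forall_notMem]
    rintro v ⟨⟨-, hv⟩, hz⟩
    have hz' : v ∈ zeroSet rootsH4 deltaH4 χ := hz
    rw [zeroSet_eq h, Set.mem_singleton_iff, zRoot_eq, ← ofCoord_single] at hz'
    rw [hz', wordProd_ofCoord] at hv
    exact not_mem_negRoots (ofCoord_mem_posRoots (applyWord_startWord_zIndex j)) hv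
  · rintro _ ⟨k, hk, rfl⟩
    have hpos := ofCoord_mem_posRoots ((applyWord_startWord_pCoord j k).1 hk)
    rw [← ofCoord_pCoord]
    change ((isSimpleSystem_H4.wordProd (startWord j) : weylGroup rootsH4) : E4 ≃ₗᵢ[ℝ] E4) _ ∈ _
    rw [wordProd_ofCoord]
    rw [ofCoord_neg] at hpos
    exact isSimpleSystem_H4.mem_negRoots_of_neg hpos
  · rintro β ⟨hβ, hβJ⟩
    rw [paramSet_eq h] at hβ
    obtain ⟨k, rfl⟩ := hβ
    rw [pRoots_mem_negSet_iff] at hβJ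
    have hpos := ofCoord_mem_posRoots ((applyWord_startWord_pCoord j k).2 hβJ)
    rw [← ofCoord_pCoord]
    change ((isSimpleSystem_H4.wordProd (startWord j) : weylGroup rootsH4) : E4 ≃ₗᵢ[ℝ] E4) _ ∈ _
    rw [wordProd_ofCoord]
    exact hpos

theorem hasSign_regionH4 {j : Fin 3} {χ : Character E4} (h : HasWeight χ (twoChi j)) :
    HasSign rootsH4 deltaH4 paramH4 χ (negSet j) (pRoots j) (signs j) := by
  intro w hw k
  rcases signs_eq j k with hk | hk
  · have hn := hw.2.1 _ (pRoots_mem_negSet_iff.2 hk)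
    rw [rootSign, if_neg fun hp => not_mem_negRoots hp hn, if_pos hn, hk]
  · have hp := hw.2.2 (pRoots j k) ⟨paramSet_eq h ▸ ⟨k, rfl⟩, fun hJ => by
      rw [pRoots_mem_negSet_iff, hk] at hJ
      exact absurd hJ (by decide)⟩
    rw [rootSign, if_pos hp, hk]

/-! ### Enumeration of the regions -/

/-- `C` is the code of `w`. -/
def IsCode (w : weylGroup rootsH4) (C : Code) : Prop :=
  ∀ i, (w : E4 ≃ₗᵢ[ℝ] E4)⁻¹ (simpleH4 i) = ofCoord (C.get i)

theorem IsCode.unique {w : weylGroup rootsH4} {C C' : Code} (h : IsCode w C)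
    (h' : IsCode w C') : C = C' := by
  have : ∀ i, C.get i = C'.get i := fun i => ofCoord_injective ((h i).symm.trans (h' i))
  exact Code.ext (this 0) (this 1) (this 2) (this 3)

theorem IsCode.eq {w w' : weylGroup rootsH4} {C : Code} (h : IsCode w C)
    (h' : IsCode w' C) : w = w' :=
  inv_injective (Subtype.ext (isometry_ext fun i => (h i).trans (h' i).symm))

/-- `w⁻¹ s_i α_k` is `w⁻¹ α_k` minus a Cartan entry times `w⁻¹ α_i`. -/
theorem IsCode.move {w : weylGroup rootsH4} {C : Code} (h : IsCode w C) (i : Fin 4) :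
    IsCode (isSimpleSystem_H4.gen i * w) (C.move i) := by
  intro k
  have hd : dot (cartan i) (single k) = (cartan i).get k := by
    revert i k
    decide +kernel
  rw [isSimpleSystem_H4.coe_gen_mul_inv_apply, ← ofCoord_single k, refl_simple_ofCoord, reflect, hd, ofCoord_add,
    ofCoord_smul, ofCoord_single, ofCoord_single, map_add, map_smul, h k, h i, ← ofCoord_smul,
    ← ofCoord_add]
  fin_cases k <;> rfl

theorem IsCode.hasWeight {w : weylGroup rootsH4} {C : Code} (h : IsCode w C)
    {χ : Character E4} {X : Coord} (hχ : HasWeight χ X) :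
    HasWeight (act (w : E4 ≃ₗᵢ[ℝ] E4) χ) (C.weight X) := by
  intro i
  rw [ev_act, h i, hχ.ev_ofCoord]
  fin_cases i <;> rfl

theorem isCode_ofWord (l : List (Fin 4)) : IsCode (isSimpleSystem_H4.wordProd l) (Code.ofWord l) := by
  intro i
  rw [← InvMemClass.coe_inv, wordProd_inv, ← ofCoord_single, wordProd_ofCoord]
  fin_cases i <;> rfl

theorem subset_explore (X : Coord) (n : ℕ) (seen frontier : List Code) :
    seen ⊆ explore X n seen frontier := by
  induction n generalizing seen frontier with
  | zero => exact fun _ h => h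
  | succ n ih => exact fun _ h => ih _ _ (List.mem_append_right _ h)

/-- Soundness of the search: it can only reach what edge moves reach from its initial lists. -/
theorem explore_induction {X : Coord} {p : Code → Prop}
    (step : ∀ C, p C → ∀ i, ((C.weight X).get i).isEdge = true → p (C.move i)) (n : ℕ)
    (seen frontier : List Code) (hs : ∀ C ∈ seen, p C) (hf : ∀ C ∈ frontier, p C) :
    ∀ C ∈ explore X n seen frontier, p C := by
  induction n generalizing seen frontier with
  | zero => exact hs
  | succ n ih =>
    have hnew : ∀ C ∈ ((frontier.flatMap (Code.neighbours X)).filter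
        fun C => decide (C ∉ seen)).dedup, p C := by
      intro C hC
      rw [List.mem_dedup, List.mem_filter, List.mem_flatMap] at hC
      obtain ⟨⟨D, hD, hC⟩, -⟩ := hC
      rw [Code.neighbours, List.mem_map] at hC
      obtain ⟨i, hi, rfl⟩ := hC
      exact step D (hf D hD) i (List.mem_filter.1 hi).2
    refine ih _ _ (fun C hC => ?_) hnew
    rcases List.mem_append.1 hC with h | h
    · exact hnew C h
    · exact hs C h

section Region

variable {j : Fin 3} {χ : Character E4} (hχ : HasWeight χ (twoChi j))

theorem paramH4_invariant (w : weylGroup rootsH4) (v : E4) :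
    paramH4 ((w : E4 ≃ₗᵢ[ℝ] E4) v) = paramH4 v := rfl

include hχ

theorem gen_mul_mem_iff_isEdge {w : weylGroup rootsH4} (hw : w ∈ regionH4 χ j) {C : Code}
    (hC : IsCode w C) (i : Fin 4) :
    isSimpleSystem_H4.gen i * w ∈ regionH4 χ j ↔ ((C.weight (twoChi j)).get i).isEdge = true := by
  rw [isSimpleSystem_H4.gen_mul_mem_region_iff (negSet_subset hχ) paramH4_invariant hw,
    isEdge_iff (hC.hasWeight hχ)]

theorem exists_of_mem_codes : ∀ C ∈ codes j, ∃ w ∈ regionH4 χ j, IsCode w C := by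
  have h0 : ∃ w ∈ regionH4 χ j, IsCode w (Code.ofWord (startWord j)) :=
    ⟨_, wordProd_startWord_mem hχ, isCode_ofWord _⟩
  refine explore_induction (fun C ⟨w, hw, hC⟩ i hi => ?_) _ _ _ (by simpa using h0)
    (by simpa using h0)
  exact ⟨_, (gen_mul_mem_iff_isEdge hχ hw hC i).2 hi, hC.move i⟩

/-- Completeness of the search: the region is connected by edges, and the list contains the starting
element and is closed under edge moves. -/
theorem exists_code {w : weylGroup rootsH4} (hw : w ∈ regionH4 χ j) :
    ∃ C ∈ codes j, IsCode w C := by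
  refine isSimpleSystem_H4.region_induction (p := fun w => ∃ C ∈ codes j, IsCode w C) (negSet_subset hχ)
    paramH4_invariant (wordProd_startWord_mem hχ) hw
    ⟨_, subset_explore _ _ _ _ (by simp), isCode_ofWord _⟩ fun u hu ⟨C, hC, huC⟩ i hi => ?_
  exact ⟨_, (((codes_spec j).2.2 C hC).1 i).1 ((gen_mul_mem_iff_isEdge hχ hu huC i).1 hi),
    huC.move i⟩

/-- The weights listed are pairwise distinct, so a weight determines its code, and a code determines
its element. -/
theorem eq_of_hasWeight {w w' : weylGroup rootsH4} (hw : w ∈ regionH4 χ j)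
    (hw' : w' ∈ regionH4 χ j) {μ : Coord} (h : HasWeight (act (w : E4 ≃ₗᵢ[ℝ] E4) χ) μ)
    (h' : HasWeight (act (w' : E4 ≃ₗᵢ[ℝ] E4) χ) μ) : w = w' := by
  obtain ⟨C, hC, hwC⟩ := exists_code hχ hw
  obtain ⟨C', hC', hwC'⟩ := exists_code hχ hw'
  have : C = C' := List.inj_on_of_nodup_map (codes_spec j).2.1 hC hC'
    (((hwC.hasWeight hχ).unique h).trans (h'.unique (hwC'.hasWeight hχ)))
  subst this
  exact hwC.eq hwC'

theorem act_injective (w : weylGroup rootsH4) (hw : w ∈ regionH4 χ j) (w' : weylGroup rootsH4)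
    (hw' : w' ∈ regionH4 χ j)
    (h : act (w : E4 ≃ₗᵢ[ℝ] E4) χ = act (w' : E4 ≃ₗᵢ[ℝ] E4) χ) : w = w' := by
  obtain ⟨C, -, hC⟩ := exists_code hχ hw
  exact eq_of_hasWeight hχ hw hw' (hC.hasWeight hχ) (h ▸ hC.hasWeight hχ)

theorem card_regionH4 : Nat.card (regionH4 χ j) = dims j := by
  choose f hf hfc using fun w : regionH4 χ j => exists_code hχ w.2
  let g : regionH4 χ j → (codes j).toFinset := fun w => ⟨f w, List.mem_toFinset.2 (hf w)⟩
  have hg : Function.Bijective g := by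
    constructor
    · intro w w' h
      have : f w = f w' := congrArg Subtype.val h
      exact Subtype.ext ((hfc w).eq (this ▸ hfc w'))
    · rintro ⟨C, hC⟩
      obtain ⟨w, hw, hwC⟩ := exists_of_mem_codes hχ C (List.mem_toFinset.1 hC)
      exact ⟨⟨w, hw⟩, Subtype.ext ((hfc ⟨w, hw⟩).unique hwC)⟩
  rw [Nat.card_congr (Equiv.ofBijective g hg), Nat.card_eq_fintype_card, Fintype.card_coe,
    List.toFinset_card_of_nodup ((codes_spec j).2.1.of_map _), (codes_spec j).1]

/-! ### Dimension, skewness and the discrete series property -/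

theorem finrank_calSpace :
    Module.finrank ℂ (CalSpace rootsH4 deltaH4 paramH4 χ (negSet j)) = dims j := by
  rw [← card_regionH4 hχ]
  exact Module.finrank_eq_nat_card_basis Finsupp.basisSingleOne

theorem ev_simple_ne_zero (i : Fin 4) (w : weylGroup rootsH4) (hw : w ∈ regionH4 χ j) :
    ev (act (w : E4 ≃ₗᵢ[ℝ] E4) χ) (simpleH4 i) ≠ 0 := by
  obtain ⟨C, hC, hwC⟩ := exists_code hχ hw
  rw [hwC.hasWeight hχ i, Ne, half_eq_zero_iff]
  exact (((codes_spec j).2.2 C hC).1 i).2.1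

/-- The rank two condition holds vacuously: no weight of the region vanishes on a root in the span
of two simple roots. -/
theorem isSkewLocalRegion :
    IsSkewLocalRegion rootsH4 deltaH4 paramH4 χ (negSet j) := by
  refine ⟨⟨negSet_subset hχ, _, wordProd_startWord_mem hχ⟩, ?_, ?_⟩
  · rintro _ ⟨i, rfl⟩ w hw
    exact ev_simple_ne_zero hχ i w hw
  · rintro _ ⟨i, rfl⟩ _ ⟨k, rfl⟩ - w hw ⟨γ, ⟨hγ, hspan⟩, h0⟩
    exfalso
    obtain ⟨C, hC, hwC⟩ := exists_code hχ hw
    -- Vanishing of the remaining coefficients places `γ` or `-γ` in `rankTwoList`.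
    have hcoeff : ∀ l, l ≠ i → l ≠ k → coeff l γ = 0 := by
      intro l hi hk
      obtain ⟨r, t, rfl⟩ := Submodule.mem_span_pair.1 hspan
      have h1 := coeff_simple l i
      have h2 := coeff_simple l k
      rw [if_neg hi] at h1
      rw [if_neg hk] at h2
      rw [coeff] at h1 h2 ⊢
      rw [inner_add_right, inner_smul_right, inner_smul_right, h1, h2, mul_zero, mul_zero,
        add_zero]
    have hmem : ∀ x ∈ posList, (∀ l, coeff l (ofCoord x) = 0 ↔ coeff l γ = 0) →
        x ∈ rankTwoList := by
      intro x hx hl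
      refine List.mem_filter.2 ⟨hx, decide_eq_true ⟨i, k, fun l hi hk => ?_⟩⟩
      rw [← Zphi.toReal_eq_zero, ← coeff_ofCoord, hl]
      exact hcoeff l hi hk
    obtain ⟨x, hx, rfl | rfl⟩ := mem_rootsH4_iff_coord.1 hγ
    · rw [(hwC.hasWeight hχ).ev_ofCoord, half_eq_zero_iff] at h0
      exact ((codes_spec j).2.2 C hC).2.1 x (hmem x hx fun _ => Iff.rfl) h0
    · rw [ofCoord_neg, ev_neg, neg_eq_zero, (hwC.hasWeight hχ).ev_ofCoord, half_eq_zero_iff] at h0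
      refine ((codes_spec j).2.2 C hC).2.1 x (hmem x hx fun l => ?_) h0
      rw [ofCoord_neg, coeff, coeff, inner_neg_right, neg_eq_zero]

theorem isDiscreteSeries {ρ : Hecke rootsH4 deltaH4 paramH4 →ₐ[ℂ]
      Module.End ℂ (CalSpace rootsH4 deltaH4 paramH4 χ (negSet j))}
    (hρ : IsCalibratedAction rootsH4 deltaH4 paramH4 χ (negSet j) ρ) : IsDiscreteSeries ρ := by
  refine ⟨isSimpleSystem_H4.isIrreducible (negSet_subset hχ) paramH4_invariant ⟨_, wordProd_startWord_mem hχ⟩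
    (act_injective hχ) hρ, ?_⟩
  rintro ψ hψ _ ⟨i, rfl⟩
  obtain ⟨w, hw, rfl⟩ := hρ.exists_of_isWeight hψ
  obtain ⟨C, hC, hwC⟩ := exists_code hχ hw
  have hcor : ∀ k, coroot (simpleH4 k) (ofCoord (weight i)) = if i = k then 1 else 0 := by
    have : ∀ i k, dot (cartan k) (weight i) = if i = k then 1 else 0 := by decide +kernel
    intro k
    rw [coroot_simple_ofCoord, this]
    split_ifs <;> simp
  refine ⟨ofCoord (weight i), ⟨by rw [hcor, if_pos rfl], ?_⟩, ?_⟩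
  · rintro _ ⟨k, rfl⟩ hk
    rw [hcor, if_neg]
    rintro rfl
    exact hk rfl
  · rw [(hwC.hasWeight hχ).ev_ofCoord]
    have := Zphi.toReal_neg_of_isNeg (((codes_spec j).2.2 C hC).1 i).2.2.1
    rw [← Complex.ofReal_ofNat, ← Complex.ofReal_div, Complex.ofReal_re]
    linarith

end Region

open Coord

/-! ### The braid relations -/

section Braid

variable {j : Fin 3} {χ : Character E4}

open Classical in
/-- The basis vector `v_w` with weight `w χ` given by `μ`. -/
noncomputable def weightVec (χ : Character E4) (j : Fin 3) (μ : Coord) :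
    CalSpace rootsH4 (Set.range simpleH4) paramH4 χ (negSet j) :=
  if h : ∃ w ∈ regionH4 χ j, HasWeight (act (w : E4 ≃ₗᵢ[ℝ] E4) χ) μ then
    basisVec rootsH4 (Set.range simpleH4) paramH4 χ (negSet j) h.choose
  else 0

/-- The linear combination of basis vectors described by a list. -/
noncomputable def combination (χ : Character E4) (j : Fin 3) (l : List (Zphi × Coord)) :
    CalSpace rootsH4 (Set.range simpleH4) paramH4 χ (negSet j) :=
  (l.map fun t => (t.1.toReal : ℂ) • weightVec χ j t.2).sum

/-- The weights of the module. -/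
def weights (j : Fin 3) : List Coord := (codes j).map (Code.weight (twoChi j))

/-- The operator of the `i`-th simple reflection. -/
noncomputable abbrev simpleOp (χ : Character E4) (j : Fin 3) (i : Fin 4) :
    Module.End ℂ (CalSpace rootsH4 (Set.range simpleH4) paramH4 χ (negSet j)) :=
  reflOp rootsH4 (Set.range simpleH4) paramH4 χ (negSet j) ⟨simpleH4 i, isSimpleSystem_H4.mem i⟩

theorem combination_cons (t : Zphi × Coord) (l : List (Zphi × Coord)) :
    combination χ j (t :: l) = (t.1.toReal : ℂ) • weightVec χ j t.2 + combination χ j l := by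
  simp [combination]

theorem combination_append (l l' : List (Zphi × Coord)) :
    combination χ j (l ++ l') = combination χ j l + combination χ j l' := by
  simp [combination]

theorem combination_addTerm (t : Zphi × Coord) (l : List (Zphi × Coord)) :
    combination χ j (addTerm t l) = (t.1.toReal : ℂ) • weightVec χ j t.2 + combination χ j l := by
  induction l with
  | nil => exact combination_cons t []
  | cons t' l ih =>
    rw [addTerm]
    split_ifs with h
    · rw [combination_cons, combination_cons, h, Zphi.toReal_add, Complex.ofReal_add, add_smul,
        add_assoc]
    · rw [combination_cons, combination_cons, ih, add_left_comm]

theorem combination_foldr_addTerm (l l' : List (Zphi × Coord)) :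
    combination χ j (l.foldr addTerm l') = combination χ j l + combination χ j l' := by
  induction l with
  | nil => simp [combination]
  | cons t l ih => rw [List.foldr_cons, combination_addTerm, ih, combination_cons, add_assoc]

theorem mem_addTerm {t : Zphi × Coord} {l : List (Zphi × Coord)} {p : Coord → Prop}
    (ht : p t.2) (hl : ∀ u ∈ l, p u.2) : ∀ u ∈ addTerm t l, p u.2 := by
  induction l with
  | nil => simpa [addTerm] using ht
  | cons t' l ih =>
    rw [List.forall_mem_cons] at hl
    rw [addTerm]
    split_ifs with h
    · exact List.forall_mem_cons.2 ⟨hl.1, hl.2⟩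
    · exact List.forall_mem_cons.2 ⟨hl.1, ih hl.2⟩

theorem mem_foldr_addTerm {l : List (Zphi × Coord)} {p : Coord → Prop}
    (hl : ∀ u ∈ l, p u.2) : ∀ u ∈ l.foldr addTerm [], p u.2 := by
  induction l with
  | nil => simp
  | cons t l ih =>
    rw [List.forall_mem_cons] at hl
    exact mem_addTerm hl.1 (ih hl.2)

theorem scale_ne_zero (j : Fin 3) : ((scale j : ℤ) : ℂ) ≠ 0 := by
  have : ∀ j, scale j ≠ 0 := by decide +kernel
  exact_mod_cast this j

/-- Closure under edge moves keeps the symbolic computation among genuine weights, where `Zphi.quot`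
is exact. -/
theorem opTerm_mem_weights {i : Fin 4} {t : Zphi × Coord} (ht : t.2 ∈ weights j) :
    ∀ u ∈ opTerm (scale j) i t, u.2 ∈ weights j := by
  obtain ⟨C, hC, hCt⟩ := List.mem_map.1 ht
  have hmove := (((codes_spec j).2.2 C hC).1 i).1
  rw [hCt] at hmove
  rw [opTerm]
  split_ifs with h
  · simp only [List.forall_mem_cons, List.not_mem_nil, false_imp_iff, implies_true, and_true]
    refine ⟨ht, List.mem_map.2 ⟨_, hmove h, ?_⟩⟩
    rw [move_weight, hCt]
  · simpa using ht

theorem opWord_mem_weights {w : List (Fin 4)} {μ : Coord} (hμ : μ ∈ weights j) :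
    ∀ u ∈ opWord (scale j) w μ, u.2 ∈ weights j := by
  induction w with
  | nil => simpa [opWord] using hμ
  | cons i w ih =>
    refine mem_foldr_addTerm fun u hu => ?_
    obtain ⟨t, ht, hut⟩ := List.mem_flatMap.1 hu
    exact opTerm_mem_weights (ih t ht) u hut

variable (hχ : HasWeight χ (twoChi j))

include hχ

theorem weightVec_eq {w : weylGroup rootsH4} (hw : w ∈ regionH4 χ j) {μ : Coord}
    (h : HasWeight (act (w : E4 ≃ₗᵢ[ℝ] E4) χ) μ) :
    weightVec χ j μ = basisVec rootsH4 (Set.range simpleH4) paramH4 χ (negSet j) w := by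
  have hex : ∃ w ∈ regionH4 χ j, HasWeight (act (w : E4 ≃ₗᵢ[ℝ] E4) χ) μ := ⟨w, hw, h⟩
  rw [weightVec, dif_pos hex,
    eq_of_hasWeight hχ hex.choose_spec.1 hw hex.choose_spec.2 h]

/-- If `x` is the value of `2wχ` at `α_i`, then `c / (wχ)(α_i) = 1 / x` because `c = 1/2`;
multiplying by `scale j` clears the denominator. The test `isEdge` decides whether the second basis
vector is present. -/
theorem combination_opTerm (i : Fin 4) {t : Zphi × Coord} (ht : t.2 ∈ weights j) :
    combination χ j (opTerm (scale j) i t) =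
      (scale j : ℂ) • simpleOp χ j i ((t.1.toReal : ℂ) • weightVec χ j t.2) := by
  obtain ⟨C, hC, hCt⟩ := List.mem_map.1 ht
  obtain ⟨w, hw, hwC⟩ := exists_of_mem_codes hχ C hC
  have hwt : HasWeight (act (w : E4 ≃ₗᵢ[ℝ] E4) χ) t.2 := hCt ▸ hwC.hasWeight hχ
  obtain ⟨-, hne, -, hq⟩ := ((codes_spec j).2.2 C hC).1 i
  rw [hCt] at hne hq
  have hx : ((t.2.get i).toReal : ℂ) ≠ 0 := by
    rwa [Ne, Complex.ofReal_eq_zero, Zphi.toReal_eq_zero]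
  have hqx : (((Zphi.quot (scale j) (t.2.get i)).toReal : ℝ) : ℂ) =
      (scale j : ℂ) / ((t.2.get i).toReal : ℂ) := by
    rw [eq_div_iff hx, ← Complex.ofReal_mul, ← Zphi.toReal_mul, hq]
    simp
  have hc : paramH4 (simpleH4 i) / ev (act (w : E4 ≃ₗᵢ[ℝ] E4) χ) (simpleH4 i) =
      1 / ((t.2.get i).toReal : ℂ) := by
    rw [hwt i, paramH4_apply]
    field_simp
  have hsum : (((⟨scale j, 0⟩ + Zphi.quot (scale j) (t.2.get i) : Zphi).toReal : ℝ) : ℂ) =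
      (scale j : ℂ) * (1 + 1 / ((t.2.get i).toReal : ℂ)) := by
    rw [Zphi.toReal_add, Complex.ofReal_add, hqx]
    simp
    ring
  rw [weightVec_eq hχ hw hwt, map_smul, reflOp_basisVec _ hw, hc]
  change _ = _ • _ • (_ + _ • basisVec _ _ _ _ _ (isSimpleSystem_H4.gen i * w))
  have hmem := gen_mul_mem_iff_isEdge hχ hw hwC i
  rw [hCt] at hmem
  rw [opTerm]
  split_ifs with h
  · have hvec := weightVec_eq hχ (hmem.2 h) ((hwC.move i).hasWeight hχ)
    rw [move_weight, hCt] at hvec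
    rw [combination_cons, combination_cons, weightVec_eq hχ hw hwt, hvec]
    simp only [Zphi.toReal_mul, Complex.ofReal_mul, hqx, hsum]
    simp only [combination, List.map_nil, List.sum_nil, add_zero]
    module
  · rw [combination_cons, weightVec_eq hχ hw hwt, basisVec_of_notMem (mt hmem.1 h)]
    simp only [Zphi.toReal_mul, Complex.ofReal_mul, hqx]
    simp only [combination, List.map_nil, List.sum_nil, add_zero, smul_zero]
    module

theorem combination_opWord (w : List (Fin 4)) {μ : Coord} (hμ : μ ∈ weights j) :
    combination χ j (opWord (scale j) w μ) =
      (scale j : ℂ) ^ w.length • (w.map (simpleOp χ j)).prod (weightVec χ j μ) := by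
  induction w with
  | nil => simp [opWord, combination]
  | cons i w ih =>
    have hop : ∀ l : List (Zphi × Coord), (∀ u ∈ l, u.2 ∈ weights j) →
        combination χ j (l.flatMap (opTerm (scale j) i)) =
          (scale j : ℂ) • simpleOp χ j i (combination χ j l) := by
      intro l hl
      induction l with
      | nil => simp [combination]
      | cons t l ihl =>
        rw [List.forall_mem_cons] at hl
        rw [List.flatMap_cons, combination_append, combination_opTerm hχ i hl.1, ihl hl.2,
          combination_cons, map_add, smul_add]
    have h := hop _ (opWord_mem_weights (w := w) hμ)
    change combination χ j ((List.flatMap _ (opWord (scale j) w μ)).foldr addTerm []) = _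
    rw [combination_foldr_addTerm, h, ih, List.map_cons, List.prod_cons, Module.End.mul_apply,
      map_smul, smul_smul, List.length_cons, pow_succ']
    simp [combination]

/-- Both alternating words have the same length, so both sides carry the same nonzero power of
`scale j`, which cancels from the checked identity. -/
theorem braid_of_lt {i k : Fin 4} (hik : i < k) :
    ((altWord (coxeterH4 i k) i k).map (simpleOp χ j)).prod =
      ((altWord (coxeterH4 i k) k i).map (simpleOp χ j)).prod := by
  refine CalSpace.hom_ext fun w hw => ?_
  obtain ⟨C, hC, hwC⟩ := exists_code hχ hw
  have hμ : C.weight (twoChi j) ∈ weights j := List.mem_map_of_mem hC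
  have hcheck := ((codes_spec j).2.2 C hC).2.2 i k hik
  rw [← weightVec_eq hχ hw (hwC.hasWeight hχ)]
  set μ := C.weight (twoChi j)
  have hzero : ∀ l : List (Zphi × Coord), (l.all fun t => decide (t.1 = 0)) = true →
      combination χ j l = 0 := by
    intro l hl
    rw [List.all_eq_true] at hl
    refine List.sum_eq_zero fun v hv => ?_
    obtain ⟨t, ht, rfl⟩ := List.mem_map.1 hv
    rw [of_decide_eq_true (hl t ht), Zphi.toReal_zero, Complex.ofReal_zero, zero_smul]
  have hneg : ∀ l : List (Zphi × Coord),
      combination χ j (l.map fun t => (-t.1, t.2)) = -combination χ j l := by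
    intro l
    induction l with
    | nil => simp [combination]
    | cons t l ih =>
      rw [List.map_cons, combination_cons, combination_cons, ih]
      simp
      abel
  have h := hzero _ hcheck
  rw [combination_foldr_addTerm, hneg, combination_opWord hχ _ hμ, combination_opWord hχ _ hμ,
    neg_add_eq_zero, length_altWord, length_altWord] at h
  exact smul_right_injective _ (pow_ne_zero _ (scale_ne_zero j)) h

theorem braid_simpleOp (i k : Fin 4) (hik : i ≠ k) :
    ((altWord (coxeterH4 i k) i k).map (simpleOp χ j)).prod =
      ((altWord (coxeterH4 i k) k i).map (simpleOp χ j)).prod := by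
  rcases lt_or_gt_of_ne hik with h | h
  · exact braid_of_lt hχ h
  · rw [isCoxeterMatrix_H4.symm i k]
    exact (braid_of_lt hχ h).symm

theorem exists_isCalibratedAction :
    ∃ ρ : Hecke rootsH4 deltaH4 paramH4 →ₐ[ℂ]
        Module.End ℂ (CalSpace rootsH4 deltaH4 paramH4 χ (negSet j)),
      IsCalibratedAction rootsH4 deltaH4 paramH4 χ (negSet j) ρ :=
  isSimpleSystem_H4.exists_calibratedAction isCoxeterMatrix_H4 (negSet_subset hχ)
    paramH4_invariant (ev_simple_ne_zero hχ) (braid_simpleOp hχ)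

end Braid

end GradedHecke

open GradedHecke in
theorem theorem6p1 (j : Fin 3) :
    (∃! χ : Character E4,
      zeroSet rootsH4 deltaH4 χ = {zRoot j} ∧
      paramSet rootsH4 paramH4 χ = Set.range (pRoots j)) ∧
    ∀ χ : Character E4,
      zeroSet rootsH4 deltaH4 χ = {zRoot j} →
      paramSet rootsH4 paramH4 χ = Set.range (pRoots j) →
      ∃ J : Set E4, J ⊆ paramSet rootsH4 paramH4 χ ∧
        IsSkewLocalRegion rootsH4 deltaH4 paramH4 χ J ∧
        HasSign rootsH4 deltaH4 paramH4 χ J (pRoots j) (signs j) ∧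
        ∃ ρ : Hecke rootsH4 deltaH4 paramH4 →ₐ[ℂ]
            Module.End ℂ (CalSpace rootsH4 deltaH4 paramH4 χ J),
          IsCalibratedAction rootsH4 deltaH4 paramH4 χ J ρ ∧
          IsDiscreteSeries ρ ∧
          Module.finrank ℂ (CalSpace rootsH4 deltaH4 paramH4 χ J) = dims j := by
  constructor
  · obtain ⟨χ, hχ⟩ := exists_hasWeight (twoChi j)
    exact ⟨χ, ⟨zeroSet_eq hχ, paramSet_eq hχ⟩, fun χ' ⟨hz, hp⟩ =>
      (hasWeight_of_sets hz hp).character_unique hχ⟩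
  · intro χ hz hp
    have hχ := hasWeight_of_sets hz hp
    obtain ⟨ρ, hρ⟩ := exists_isCalibratedAction hχ
    exact ⟨negSet j, negSet_subset hχ, isSkewLocalRegion hχ, hasSign_regionH4 hχ, ρ, hρ,
      isDiscreteSeries hχ hρ, finrank_calSpace hχ⟩
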